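/- **Theorem 6.12 (associated family criterion).** Fix a constant $H\neq 0$. For $\lambda\in\mathbb R$ let $M_\lambda(t)$ be the screw motion of $\mathbb E^3$ that rotates by the angle $t$ about the $z$-axis and translates by $\lambda t$ along it. A *cmc-$H$ helicoid of pitch $\lambda$* is a smooth immersion $x(u,v)=M_\lambda(v)\,c(u)$, $(u,v)\in\mathbb R^2$, with smooth generating curve $c:\mathbb R\to\mathbb E^3$, for which $(u,v)$ are isothermal parameters and whose mean curvature with respect to the unit normal $n=(x_u\times x_v)/|x_u\times x_v|$ is constant equal to $H$ (here $\mathrm{II}=-\langle dx,dn\rangle$ and $H=\frac12\operatorname{tr}_{\mathrm I}\mathrm{II}$). Its *inner radius* $\rho$ and *outer radius* $R$ are the infimum and the supremum over the surface of the distance to the $z$-axis. Two such surfaces $x_1,x_2$ *belong to the same associated family* if, after an orientation-preserving diffeomorphism of the parameter plane, they have the same first fundamental form and the same mean curvature, and their Hopf differentials satisfy $Q_2=e^{i\theta}Q_1$ for a constant $\theta\in\mathbb R$, where $Q=\left(\tfrac{L-N}{2}-iM\right)(du+i\,dv)^2$ for $\mathrm{II}=L\,du^2+2M\,du\,dv+N\,dv^2$.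 They are *locally isometric* if every point of the parameter plane of each surface has a neighbourhood with a smooth map into the parameter plane of the other surface that pulls back the first fundamental form of the latter to that of the former. Let two cmc-$H$ helicoids have pitches $\lambda_i$, inner radii $\rho_i$ and outer radii $R_i$ $(i=1,2)$. Then they belong to the same associated family if and only if $$\frac{\lambda_1^2+\rho_1^2}{\lambda_1^2+R_1^2}=\frac{\lambda_2^2+\rho_2^2}{\lambda_2^2+R_2^2},$$ and they are locally isometric if and only if the same equality holds. Moreover, for every cmc-$H$ helicoid, $$\frac{\lambda^2+\rho^2}{\lambda^2+R^2}=\frac{\lambda^2+(R-1/|H|)^2}{\lambda^2+R^2}$$ (for $H=-\tfrac12$ the right-hand side is $\frac{\lambda^2+(R-2)^2}{\lambda^2+R^2}$). -/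

import Mathlib

open scoped ContDiff

noncomputable section

/-- Euclidean three-space. -/
abbrev E3 : Type := EuclideanSpace ℝ (Fin 3)

/-- The vector product of Euclidean three-space. -/
def cross (a b : E3) : E3 := WithLp.toLp 2 (crossProduct a.ofLp b.ofLp)

/-! ### Parametrized surfaces `x : ℝ × ℝ → E3` -/

/-- The first fundamental form `I = ⟨dx, dx⟩` at the point `p`. -/
def firstForm (x : ℝ × ℝ → E3) (p ξ η : ℝ × ℝ) : ℝ :=
  inner ℝ (fderiv ℝ x p ξ) (fderiv ℝ x p η)

/-- The Gauss map `n = (x_u × x_v) / |x_u × x_v|`. -/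
def gaussMap (x : ℝ × ℝ → E3) (p : ℝ × ℝ) : E3 :=
  ‖cross (fderiv ℝ x p (1, 0)) (fderiv ℝ x p (0, 1))‖⁻¹ •
    cross (fderiv ℝ x p (1, 0)) (fderiv ℝ x p (0, 1))

/-- The second fundamental form `II = -⟨dx, dn⟩` at the point `p`. -/
def secondForm (x : ℝ × ℝ → E3) (p ξ η : ℝ × ℝ) : ℝ :=
  -inner ℝ (fderiv ℝ x p ξ) (fderiv ℝ (gaussMap x) p η)

/-- The mean curvature `(E N - 2 F M + G L) / (2 (E G - F ^ 2))`, that is, half the trace of `II`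
with respect to `I`. -/
def meanCurvature (x : ℝ × ℝ → E3) (p : ℝ × ℝ) : ℝ :=
  (firstForm x p (1, 0) (1, 0) * secondForm x p (0, 1) (0, 1)
      - 2 * firstForm x p (1, 0) (0, 1) * secondForm x p (1, 0) (0, 1)
      + firstForm x p (0, 1) (0, 1) * secondForm x p (1, 0) (1, 0)) /
    (2 * (firstForm x p (1, 0) (1, 0) * firstForm x p (0, 1) (0, 1)
      - firstForm x p (1, 0) (0, 1) ^ 2))

/-- `x` is an immersion for which the parameters `(u, v)` are isothermal: `I` is a positive
multiple of `du ^ 2 + dv ^ 2` at every point. -/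
structure IsConformalImmersion (x : ℝ × ℝ → E3) : Prop where
  smooth : ContDiff ℝ ∞ x
  immersion : ∀ p, Function.Injective (fderiv ℝ x p)
  orthogonal : ∀ p, firstForm x p (1, 0) (0, 1) = 0
  isothermal : ∀ p, firstForm x p (1, 0) (1, 0) = firstForm x p (0, 1) (0, 1)

/-- The Hopf differential of a conformal immersion, in its isothermal parameters:
`Q = ((L - N) / 2 - i M) (du + i dv) ^ 2`, evaluated on the tangent vector `ξ` at `p`.
(So the real part of `Q` is `II - H I`.) -/
def hopfDifferential (x : ℝ × ℝ → E3) (p ξ : ℝ × ℝ) : ℂ :=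
  ((((secondForm x p (1, 0) (1, 0) - secondForm x p (0, 1) (0, 1)) / 2 : ℝ) : ℂ)
      - Complex.I * ((secondForm x p (1, 0) (0, 1) : ℝ) : ℂ)) *
    (((ξ.1 : ℝ) : ℂ) + Complex.I * ((ξ.2 : ℝ) : ℂ)) ^ 2

/-- `Φ` pulls the first fundamental form of `x₂` back to that of `x₁` at the point `p`. -/
def IsometricAt (x₁ x₂ : ℝ × ℝ → E3) (Φ : ℝ × ℝ → ℝ × ℝ) (p : ℝ × ℝ) : Prop :=
  ∀ ξ η, firstForm x₂ (Φ p) (fderiv ℝ Φ p ξ) (fderiv ℝ Φ p η) = firstForm x₁ p ξ η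

/-- Two conformal immersions of the plane belong to the same associated family: up to an
orientation-preserving change of parameters they have the same first fundamental form and the same
mean curvature, and their Hopf differentials differ by a constant phase `e ^ (i θ)`. -/
def SameAssociatedFamily (x₁ x₂ : ℝ × ℝ → E3) : Prop :=
  ∃ (Φ : ℝ × ℝ ≃ ℝ × ℝ) (θ : ℝ),
    ContDiff ℝ ∞ Φ ∧ ContDiff ℝ ∞ Φ.symm ∧
    ∀ p, 0 < (fderiv ℝ Φ p).det ∧
      IsometricAt x₁ x₂ Φ p ∧
      meanCurvature x₂ (Φ p) = meanCurvature x₁ p ∧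
      ∀ ξ, hopfDifferential x₂ (Φ p) (fderiv ℝ Φ p ξ) =
        Complex.exp (θ * Complex.I) * hopfDifferential x₁ p ξ

/-- Every point of the surface `x₁` has a neighbourhood that is mapped isometrically into the
surface `x₂`. -/
def LocallyIsometricInto (x₁ x₂ : ℝ × ℝ → E3) : Prop :=
  ∀ p : ℝ × ℝ, ∃ (U : Set (ℝ × ℝ)) (Φ : ℝ × ℝ → ℝ × ℝ),
    IsOpen U ∧ p ∈ U ∧ ContDiffOn ℝ ∞ Φ U ∧ ∀ q ∈ U, IsometricAt x₁ x₂ Φ q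

/-- The two surfaces are locally isometric. -/
def LocallyIsometric (x₁ x₂ : ℝ × ℝ → E3) : Prop :=
  LocallyIsometricInto x₁ x₂ ∧ LocallyIsometricInto x₂ x₁

/-! ### Helicoidal surfaces -/

/-- The helicoidal (screw) motion `M_l(t)` of pitch `l` about the third axis. -/
def helicoidalMotion (l t : ℝ) (p : E3) : E3 :=
  !₂[Real.cos t * p 0 - Real.sin t * p 1, Real.sin t * p 0 + Real.cos t * p 1, p 2 + l * t]

/-- The helicoidal surface `x(u, v) = M_l(v) c(u)` of pitch `l` with generating curve `c`. -/
def helicoidalSurface (l : ℝ) (c : ℝ → E3) (p : ℝ × ℝ) : E3 :=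
  helicoidalMotion l p.2 (c p.1)

/-- The helicoidal surface of pitch `l` with generating curve `c` is a cmc-`H` helicoid, presented
in isothermal parameters `(u, v)` and extended as far as possible (all of the plane). -/
structure IsCmcHelicoid (H l : ℝ) (c : ℝ → E3) : Prop where
  smooth : ContDiff ℝ ∞ c
  conformal : IsConformalImmersion (helicoidalSurface l c)
  cmc : ∀ p, meanCurvature (helicoidalSurface l c) p = H

/-- The distance from the third axis. -/
def axisDist (p : E3) : ℝ := Real.sqrt (p 0 ^ 2 + p 1 ^ 2)

/-- The inner radius: the radius of the largest circular cylinder about the axis which the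
surface stays outside of. -/
def innerRadius (x : ℝ × ℝ → E3) : ℝ := sInf (Set.range fun p => axisDist (x p))

/-- The outer radius: the radius of the smallest circular cylinder about the axis which
contains the surface. -/
def outerRadius (x : ℝ × ℝ → E3) : ℝ := sSup (Set.range fun p => axisDist (x p))

end

/-! In isothermal parameters the metric is `g(u) (du² + dv²)`, where `g` (`conformalFactor`) is the
squared distance to the axis plus `λ²`. With `z` the height of the generating curve, the second form
has `N = z'`, `M = -λ`, and constant mean curvature gives `L = 2Hg - z'`. Since `z'' = H g'`, the
quantity `a = z' - H (g - λ²)` is constant. Hence the Hopf coefficient is the constant `q + iλ` with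
`q = Hλ² - a`, and eliminating `z'` from the isothermal relations leaves `g'² = -4H² g (g - m)(g -
M)`, where `H² m M = λ² + q²` and `H² (m + M) = 1 + 2Hq` (`IsCmcHelicoid.exists_profile`).

Every solution has infimum `m` and attains its maximum `M` (`isGLB_range`, `exists_eq_max`), so `λ²
+ ρ² = m` and `λ² + R² = M`: the ratio in the theorem is `m / M`. The formula in `R` and `H` alone
follows from the two Vieta relations.

The Gauss curvature is `H² (1 - m M / g²)`, with greatest value `H² (1 - m / M)`, attained where `g
= M`. Curvature is invariant under isometries, so local isometries in both directions force equal
ratios (`ratio_le_of_locallyIsometricInto`). Conversely, if the ratios agree, a homothety and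
translation of the parameter plane carries one profile to the other by uniqueness for the profile
equation. The squared modulus of the Hopf coefficient is `H² m M`, which scales accordingly, so only
a constant phase remains (`sameAssociatedFamily_of_ratio_eq`). Members of one associated family are
isometric, which closes the circle. -/

noncomputable section

/-! ### Curves and helicoidal motions in coordinates -/

lemma hasDerivAt_E3 {f : ℝ → E3} {f' : E3} {t : ℝ} :
    HasDerivAt f f' t ↔ ∀ i, HasDerivAt (fun s => f s i) (f' i) t := by
  simp only [hasDerivAt_iff_hasFDerivAt, ← hasFDerivWithinAt_univ]
  rw [hasFDerivWithinAt_euclidean]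
  refine forall_congr' fun i => ?_
  rw [show (PiLp.proj 2 (fun _ : Fin 3 => ℝ) i).comp (ContinuousLinearMap.toSpanSingleton ℝ f') =
    ContinuousLinearMap.toSpanSingleton ℝ (f' i) from by ext; simp]

lemma inner_E3 (a b : E3) : inner ℝ a b = a 0 * b 0 + a 1 * b 1 + a 2 * b 2 := by
  simp [PiLp.inner_apply, Fin.sum_univ_three, mul_comm]

/-- The velocity at `p` of the helicoidal motion of pitch `l`. -/
def screwField (l : ℝ) (p : E3) : E3 := !₂[-p 1, p 0, l]

/-- Pitch zero gives the rotation that is the linear part of every `helicoidalMotion l v`. Its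
invariance properties reduce the fundamental forms to computations on the generating curve alone. -/
lemma inner_helicoidalMotion_zero (v : ℝ) (a b : E3) :
    inner ℝ (helicoidalMotion 0 v a) (helicoidalMotion 0 v b) = inner ℝ a b := by
  simp only [inner_E3, helicoidalMotion]
  simp
  linear_combination (a 0 * b 0 + a 1 * b 1) * Real.sin_sq_add_cos_sq v

lemma cross_helicoidalMotion_zero (v : ℝ) (a b : E3) :
    cross (helicoidalMotion 0 v a) (helicoidalMotion 0 v b) =
      helicoidalMotion 0 v (cross a b) := by
  ext i
  fin_cases i
  · simp [cross, helicoidalMotion, cross_apply]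
    ring
  · simp [cross, helicoidalMotion, cross_apply]
    ring
  · simp [cross, helicoidalMotion, cross_apply]
    linear_combination (a 0 * b 1 - a 1 * b 0) * Real.sin_sq_add_cos_sq v

lemma helicoidalMotion_zero_smul (v k : ℝ) (a : E3) :
    helicoidalMotion 0 v (k • a) = k • helicoidalMotion 0 v a := by
  ext i
  fin_cases i <;> simp [helicoidalMotion] <;> ring

lemma norm_helicoidalMotion_zero (v : ℝ) (a : E3) : ‖helicoidalMotion 0 v a‖ = ‖a‖ := by
  have h := inner_helicoidalMotion_zero v a a
  rw [real_inner_self_eq_norm_sq, real_inner_self_eq_norm_sq] at h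
  exact (sq_eq_sq₀ (norm_nonneg _) (norm_nonneg _)).1 h

lemma differentiable_helicoidalSurface {l : ℝ} {c : ℝ → E3} (hc : Differentiable ℝ c) :
    Differentiable ℝ (helicoidalSurface l c) := by
  have h := differentiable_euclidean.1 hc
  rw [differentiable_euclidean]
  intro i
  have h0 := h 0
  have h1 := h 1
  have h2 := h 2
  fin_cases i <;> simp [helicoidalSurface, helicoidalMotion] <;> fun_prop

lemma fderiv_helicoidalSurface_fst {l : ℝ} {c : ℝ → E3} (hc : Differentiable ℝ c) (p : ℝ × ℝ) :
    fderiv ℝ (helicoidalSurface l c) p (1, 0) = helicoidalMotion 0 p.2 (deriv c p.1) := by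
  have hl : HasDerivAt (fun u : ℝ => (u, p.2)) (1, 0) p.1 :=
    (hasDerivAt_id p.1).prodMk (hasDerivAt_const p.1 p.2)
  have h1 := (differentiable_helicoidalSurface (l := l) hc p).hasFDerivAt.comp_hasDerivAt p.1 hl
  refine h1.unique ?_
  have h := hasDerivAt_E3.1 (hc p.1).hasDerivAt
  rw [hasDerivAt_E3]
  refine Fin.forall_fin_succ.2 ⟨?_, Fin.forall_fin_two.2 ⟨?_, ?_⟩⟩
  · exact (((h 0).const_mul (Real.cos p.2)).fun_sub ((h 1).const_mul (Real.sin p.2)))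
  · exact (((h 0).const_mul (Real.sin p.2)).fun_add ((h 1).const_mul (Real.cos p.2)))
  · exact ((h 2).add_const (l * p.2)).congr_deriv (by simp [helicoidalMotion])

lemma fderiv_helicoidalSurface_snd {l : ℝ} {c : ℝ → E3} (hc : Differentiable ℝ c) (p : ℝ × ℝ) :
    fderiv ℝ (helicoidalSurface l c) p (0, 1) =
      helicoidalMotion 0 p.2 (screwField l (c p.1)) := by
  have hl : HasDerivAt (fun v : ℝ => (p.1, v)) (0, 1) p.2 :=
    (hasDerivAt_const p.2 p.1).prodMk (hasDerivAt_id p.2)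
  have h1 := (differentiable_helicoidalSurface (l := l) hc p).hasFDerivAt.comp_hasDerivAt p.2 hl
  refine h1.unique ?_
  have hs := Real.hasDerivAt_sin p.2
  have hk := Real.hasDerivAt_cos p.2
  rw [hasDerivAt_E3]
  refine Fin.forall_fin_succ.2 ⟨?_, Fin.forall_fin_two.2 ⟨?_, ?_⟩⟩
  · exact ((hk.mul_const (c p.1 0)).fun_sub (hs.mul_const (c p.1 1))).congr_deriv
      (by simp [helicoidalMotion, screwField]; ring)
  · exact ((hs.mul_const (c p.1 0)).fun_add (hk.mul_const (c p.1 1))).congr_deriv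
      (by simp [helicoidalMotion, screwField]; ring)
  · exact (((hasDerivAt_id p.2).const_mul l).const_add (c p.1 2)).congr_deriv
      (by simp [helicoidalMotion, screwField])

lemma firstForm_apply (x : ℝ × ℝ → E3) (p ξ η : ℝ × ℝ) :
    firstForm x p ξ η = firstForm x p (1, 0) (1, 0) * (ξ.1 * η.1)
      + firstForm x p (1, 0) (0, 1) * (ξ.1 * η.2 + ξ.2 * η.1)
      + firstForm x p (0, 1) (0, 1) * (ξ.2 * η.2) := by
  have key : ∀ ζ : ℝ × ℝ, fderiv ℝ x p ζ =
      ζ.1 • fderiv ℝ x p (1, 0) + ζ.2 • fderiv ℝ x p (0, 1) := fun ζ => by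
    rw [← map_smul, ← map_smul, ← map_add]; simp
  unfold firstForm
  rw [key ξ, key η]
  simp only [inner_add_left, inner_add_right, real_inner_smul_left, real_inner_smul_right]
  rw [real_inner_comm (fderiv ℝ x p (1, 0)) (fderiv ℝ x p (0, 1))]
  ring

/-! ### The fundamental forms of a helicoidal surface in isothermal parameters -/

/-- The factor `g` of the metric `g (du ^ 2 + dv ^ 2)` of a helicoidal surface in isothermal
parameters. -/
def conformalFactor (l : ℝ) (c : ℝ → E3) (u : ℝ) : ℝ := c u 0 ^ 2 + c u 1 ^ 2 + l ^ 2

/-- Half the derivative of `conformalFactor`. -/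
def radialProduct (c : ℝ → E3) (u : ℝ) : ℝ := c u 0 * deriv c u 0 + c u 1 * deriv c u 1

section Conformal

variable {l : ℝ} {c : ℝ → E3}

lemma firstForm_fst_fst (hc : Differentiable ℝ c) (p : ℝ × ℝ) :
    firstForm (helicoidalSurface l c) p (1, 0) (1, 0) =
      deriv c p.1 0 ^ 2 + deriv c p.1 1 ^ 2 + deriv c p.1 2 ^ 2 := by
  rw [firstForm, fderiv_helicoidalSurface_fst hc, inner_helicoidalMotion_zero, inner_E3]
  ring

lemma firstForm_fst_snd (hc : Differentiable ℝ c) (p : ℝ × ℝ) :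
    firstForm (helicoidalSurface l c) p (1, 0) (0, 1) =
      c p.1 0 * deriv c p.1 1 - c p.1 1 * deriv c p.1 0 + l * deriv c p.1 2 := by
  rw [firstForm, fderiv_helicoidalSurface_fst hc, fderiv_helicoidalSurface_snd hc,
    inner_helicoidalMotion_zero, inner_E3]
  simp [screwField]
  ring

lemma firstForm_snd_snd (hc : Differentiable ℝ c) (p : ℝ × ℝ) :
    firstForm (helicoidalSurface l c) p (0, 1) (0, 1) = conformalFactor l c p.1 := by
  rw [firstForm, fderiv_helicoidalSurface_snd hc, inner_helicoidalMotion_zero, inner_E3]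
  simp [screwField, conformalFactor]
  ring

lemma differentiable_of_smooth (hc : ContDiff ℝ ∞ c) : Differentiable ℝ c :=
  hc.differentiable (by simp)

lemma differentiable_deriv_of_smooth (hc : ContDiff ℝ ∞ c) : Differentiable ℝ (deriv c) :=
  (contDiff_infty.1 hc 2).differentiable_deriv_two

lemma isothermal_orthogonal (hc : ContDiff ℝ ∞ c)
    (hx : IsConformalImmersion (helicoidalSurface l c)) (u : ℝ) :
    c u 0 * deriv c u 1 - c u 1 * deriv c u 0 + l * deriv c u 2 = 0 := by
  rw [← firstForm_fst_snd (differentiable_of_smooth hc) (u, 0)]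
  exact hx.orthogonal (u, 0)

lemma isothermal_normSq (hc : ContDiff ℝ ∞ c)
    (hx : IsConformalImmersion (helicoidalSurface l c)) (u : ℝ) :
    deriv c u 0 ^ 2 + deriv c u 1 ^ 2 + deriv c u 2 ^ 2 = conformalFactor l c u := by
  rw [← firstForm_snd_snd (differentiable_of_smooth hc) (u, 0),
    ← firstForm_fst_fst (l := l) (differentiable_of_smooth hc) (u, 0)]
  exact hx.isothermal (u, 0)

lemma conformalFactor_pos (hc : ContDiff ℝ ∞ c)
    (hx : IsConformalImmersion (helicoidalSurface l c)) (u : ℝ) : 0 < conformalFactor l c u := by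
  rw [← firstForm_snd_snd (differentiable_of_smooth hc) (u, 0), firstForm]
  refine real_inner_self_pos.2 fun h => ?_
  have := hx.immersion (u, 0) (h.trans (map_zero _).symm)
  simp at this

lemma firstForm_eq (hc : ContDiff ℝ ∞ c)
    (hx : IsConformalImmersion (helicoidalSurface l c)) (p ξ η : ℝ × ℝ) :
    firstForm (helicoidalSurface l c) p ξ η =
      conformalFactor l c p.1 * (ξ.1 * η.1 + ξ.2 * η.2) := by
  rw [firstForm_apply, hx.orthogonal, hx.isothermal,
    firstForm_snd_snd (differentiable_of_smooth hc)]
  ring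

/-- The Gauss map of a helicoidal surface is obtained by rotating it along the generating
curve. -/
lemma gaussMap_eq (hc : ContDiff ℝ ∞ c)
    (hx : IsConformalImmersion (helicoidalSurface l c)) :
    gaussMap (helicoidalSurface l c) = helicoidalSurface 0
    (fun u => (conformalFactor l c u)⁻¹ • cross (deriv c u) (screwField l (c u))) := by
  funext p
  have hd := differentiable_of_smooth hc
  -- Lagrange's identity: the two factors are orthogonal and both have squared length `g`.
  have hn : ‖cross (deriv c p.1) (screwField l (c p.1))‖ = conformalFactor l c p.1 := by
    refine (sq_eq_sq₀ (norm_nonneg _) (conformalFactor_pos hc hx _).le).1 ?_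
    rw [← real_inner_self_eq_norm_sq, inner_E3]
    have h1 := isothermal_orthogonal hc hx p.1
    have h2 := isothermal_normSq hc hx p.1
    simp only [cross, cross_apply, screwField]
    simp
    set d := deriv c p.1
    have h3 : conformalFactor l c p.1 = c p.1 0 ^ 2 + c p.1 1 ^ 2 + l ^ 2 := rfl
    linear_combination (conformalFactor l c p.1) * h2 -
      (d 0 ^ 2 + d 1 ^ 2 + d 2 ^ 2) * h3
      - (c p.1 0 * d 1 - c p.1 1 * d 0 + l * d 2) * h1
  rw [gaussMap, fderiv_helicoidalSurface_fst hd, fderiv_helicoidalSurface_snd hd,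
    cross_helicoidalMotion_zero, norm_helicoidalMotion_zero, hn, ← helicoidalMotion_zero_smul]
  rfl

lemma hasDerivAt_coord (hc : ContDiff ℝ ∞ c) (u : ℝ) (i : Fin 3) :
    HasDerivAt (fun u => c u i) (deriv c u i) u :=
  hasDerivAt_E3.1 (differentiable_of_smooth hc u).hasDerivAt i

lemma hasDerivAt_deriv_coord (hc : ContDiff ℝ ∞ c) (u : ℝ) (i : Fin 3) :
    HasDerivAt (fun u => deriv c u i) (deriv (deriv c) u i) u :=
  hasDerivAt_E3.1 (differentiable_deriv_of_smooth hc u).hasDerivAt i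

lemma hasDerivAt_conformalFactor (hc : ContDiff ℝ ∞ c) (u : ℝ) :
    HasDerivAt (conformalFactor l c) (2 * radialProduct c u) u :=
  ((((hasDerivAt_coord hc u 0).fun_pow 2).fun_add
    ((hasDerivAt_coord hc u 1).fun_pow 2)).add_const (l ^ 2)).congr_deriv
      (by simp [radialProduct]; ring)

lemma differentiable_normal (hc : ContDiff ℝ ∞ c)
    (hx : IsConformalImmersion (helicoidalSurface l c)) :
    Differentiable ℝ (fun u => (conformalFactor l c u)⁻¹ • cross (deriv c u) (screwField l (c u))) := by
  refine Differentiable.fun_smul (F := E3) (fun u => ?_) ?_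
  · exact (hasDerivAt_conformalFactor hc u).differentiableAt.inv
      (conformalFactor_pos hc hx u).ne'
  · have h : ∀ i, Differentiable ℝ fun u => c u i := fun i u =>
      (hasDerivAt_coord hc u i).differentiableAt
    have h' : ∀ i, Differentiable ℝ fun u => deriv c u i := fun i u =>
      (hasDerivAt_deriv_coord hc u i).differentiableAt
    have h0 := h 0
    have h1 := h 1
    have h0' := h' 0
    have h1' := h' 1
    have h2' := h' 2
    rw [differentiable_euclidean]
    intro i
    fin_cases i <;> simp [cross, cross_apply, screwField] <;> fun_prop

lemma secondForm_snd_snd (hc : ContDiff ℝ ∞ c)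
    (hx : IsConformalImmersion (helicoidalSurface l c)) (p : ℝ × ℝ) :
    secondForm (helicoidalSurface l c) p (0, 1) (0, 1) = deriv c p.1 2 := by
  rw [secondForm, gaussMap_eq hc hx, fderiv_helicoidalSurface_snd (differentiable_of_smooth hc),
    fderiv_helicoidalSurface_snd (differentiable_normal hc hx), inner_helicoidalMotion_zero,
    inner_E3]
  have h0 := conformalFactor_pos hc hx p.1
  have h1 := isothermal_orthogonal hc hx p.1
  have h3 : conformalFactor l c p.1 = c p.1 0 ^ 2 + c p.1 1 ^ 2 + l ^ 2 := rfl
  simp [cross, cross_apply, screwField]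
  field_simp
  linear_combination (-deriv c p.1 2) * h3 - l * h1

lemma secondForm_fst_snd (hc : ContDiff ℝ ∞ c)
    (hx : IsConformalImmersion (helicoidalSurface l c)) (p : ℝ × ℝ) :
    secondForm (helicoidalSurface l c) p (1, 0) (0, 1) = -l := by
  rw [secondForm, gaussMap_eq hc hx, fderiv_helicoidalSurface_fst (differentiable_of_smooth hc),
    fderiv_helicoidalSurface_snd (differentiable_normal hc hx), inner_helicoidalMotion_zero,
    inner_E3]
  have h0 := conformalFactor_pos hc hx p.1
  have h1 := isothermal_orthogonal hc hx p.1
  have h2 := isothermal_normSq hc hx p.1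
  simp [cross, cross_apply, screwField]
  field_simp
  linear_combination deriv c p.1 2 * h1 - l * h2

/-- Differentiating `⟪c', n⟫ = 0` along the generating curve moves the derivative from the normal to
`c'`. The factor `g` clears the denominator of the normal. -/
lemma secondForm_fst_fst (hc : ContDiff ℝ ∞ c)
    (hx : IsConformalImmersion (helicoidalSurface l c)) (p : ℝ × ℝ) :
    secondForm (helicoidalSurface l c) p (1, 0) (1, 0) * conformalFactor l c p.1 =
      inner ℝ (deriv (deriv c) p.1) (cross (deriv c p.1) (screwField l (c p.1))) := by
  have h0 := conformalFactor_pos hc hx p.1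
  set m : ℝ → E3 :=
    fun u => (conformalFactor l c u)⁻¹ • cross (deriv c u) (screwField l (c u)) with hm
  have hmd : Differentiable ℝ m := differentiable_normal hc hx
  have hz : ∀ u, inner ℝ (deriv c u) (m u) = 0 := fun u => by
    rw [hm, inner_E3]
    simp [cross, cross_apply, screwField]
    ring
  have hd := (differentiable_deriv_of_smooth hc p.1).hasDerivAt.inner ℝ (hmd p.1).hasDerivAt
  have hd0 := hd.unique ((hasDerivAt_const p.1 (0 : ℝ)).congr_of_eventuallyEq
    (Filter.Eventually.of_forall hz))
  have hII : secondForm (helicoidalSurface l c) p (1, 0) (1, 0) =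
      inner ℝ (deriv (deriv c) p.1) (m p.1) := by
    rw [secondForm, gaussMap_eq hc hx,
      fderiv_helicoidalSurface_fst (differentiable_of_smooth hc),
      fderiv_helicoidalSurface_fst hmd, inner_helicoidalMotion_zero]
    linarith
  rw [hII, hm, real_inner_smul_right]
  field_simp

end Conformal

/-! ### The conformal factor of a cmc helicoid -/

/-- `g > 0` with derivative `g'` solves `g' ^ 2 = -4 H ^ 2 g (g - m) (g - M)` together with the
differentiated equation `g'' = -2 H ^ 2 ((g - m) (g - M) + g (2 g - m - M))`. -/
structure IsConformalProfile (H m M : ℝ) (g g' : ℝ → ℝ) : Prop where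
  nonneg : 0 ≤ m
  le : m ≤ M
  pos : ∀ u, 0 < g u
  hasDerivAt : ∀ u, HasDerivAt g (g' u) u
  hasDerivAt' : ∀ u,
    HasDerivAt g' (-2 * H ^ 2 * ((g u - m) * (g u - M) + g u * (2 * g u - m - M))) u
  energy : ∀ u, g' u ^ 2 = -4 * H ^ 2 * g u * ((g u - m) * (g u - M))

/-- Expansion of `⟪e, r⟫` in the frame `d, b, d × b`. -/
lemma inner_frame_expansion (e d b r : E3) :
    inner ℝ (cross d b) (cross d b) * inner ℝ e r =
      inner ℝ (cross d b) r * inner ℝ e (cross d b)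
      + (inner ℝ b b * inner ℝ d r - inner ℝ d b * inner ℝ b r) * inner ℝ e d
      + (inner ℝ d d * inner ℝ b r - inner ℝ d b * inner ℝ d r) * inner ℝ e b := by
  simp only [inner_E3, cross, cross_apply]
  simp
  ring

lemma inner_cross_self (d b : E3) :
    inner ℝ (cross d b) (cross d b) =
      inner ℝ d d * inner ℝ b b - inner ℝ d b ^ 2 := by
  simp only [inner_E3, cross, cross_apply]
  simp
  ring

section Cmc

variable {H l : ℝ} {c : ℝ → E3}

lemma IsCmcHelicoid.secondForm_fst_fst (h : IsCmcHelicoid H l c) (p : ℝ × ℝ) :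
    secondForm (helicoidalSurface l c) p (1, 0) (1, 0) =
      2 * H * conformalFactor l c p.1 - deriv c p.1 2 := by
  have hm := h.cmc p
  have hg := conformalFactor_pos h.smooth h.conformal p.1
  rw [meanCurvature, secondForm_snd_snd h.smooth h.conformal,
    firstForm_eq h.smooth h.conformal, firstForm_eq h.smooth h.conformal,
    firstForm_eq h.smooth h.conformal, div_eq_iff (by simp; positivity)] at hm
  simp at hm
  have : conformalFactor l c p.1 * (secondForm (helicoidalSurface l c) p (1, 0) (1, 0) -
      (2 * H * conformalFactor l c p.1 - deriv c p.1 2)) = 0 := by linear_combination hm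
  have := (mul_eq_zero.1 this).resolve_left hg.ne'
  linarith

/-- The components of the second derivative of the generating curve. -/
lemma IsCmcHelicoid.inner_deriv_deriv (h : IsCmcHelicoid H l c) (u : ℝ) (r : E3) :
    conformalFactor l c u * inner ℝ (deriv (deriv c) u) r =
      inner ℝ (cross (deriv c u) (screwField l (c u))) r *
        (2 * H * conformalFactor l c u - deriv c u 2)
      + inner ℝ (deriv c u) r * radialProduct c u := by
  have hg := conformalFactor_pos h.smooth h.conformal u
  have h1 := isothermal_orthogonal h.smooth h.conformal
  have h2 := isothermal_normSq h.smooth h.conformal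
  have hN := _root_.secondForm_fst_fst h.smooth h.conformal (u, 0)
  rw [h.secondForm_fst_fst] at hN
  have hc := hasDerivAt_coord h.smooth u
  have hd := hasDerivAt_deriv_coord h.smooth u
  have hdd : inner ℝ (deriv c u) (deriv c u) = conformalFactor l c u := by
    rw [inner_E3]; linear_combination h2 u
  have hbb : inner ℝ (screwField l (c u)) (screwField l (c u)) = conformalFactor l c u := by
    rw [inner_E3]; simp [screwField, conformalFactor]; ring
  have hdb : inner ℝ (deriv c u) (screwField l (c u)) = 0 := by
    rw [inner_E3]; simp [screwField]; linear_combination h1 u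
  have hed : inner ℝ (deriv (deriv c) u) (deriv c u) = radialProduct c u := by
    have e1 := (((hd 0).fun_pow 2).fun_add ((hd 1).fun_pow 2)).fun_add ((hd 2).fun_pow 2)
    have e2 := hasDerivAt_conformalFactor (l := l) h.smooth u
    rw [← funext h2] at e2
    have := e1.unique e2
    simp at this
    rw [inner_E3]
    linarith
  have heb : inner ℝ (deriv (deriv c) u) (screwField l (c u)) = 0 := by
    have e1 := (((hc 0).fun_mul (hd 1)).fun_sub ((hc 1).fun_mul (hd 0))).fun_add
      ((hd 2).const_mul l)
    have e2 := e1.unique ((hasDerivAt_const u (0 : ℝ)).congr_of_eventuallyEq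
      (Filter.Eventually.of_forall h1))
    rw [inner_E3]
    simp [screwField]
    linarith
  have hf := inner_frame_expansion (deriv (deriv c) u) (deriv c u) (screwField l (c u)) r
  rw [inner_cross_self, hdd, hbb, hdb, heb, hed] at hf
  have hN' : inner ℝ (deriv (deriv c) u) (cross (deriv c u) (screwField l (c u))) =
      (2 * H * conformalFactor l c u - deriv c u 2) * conformalFactor l c u := hN.symm
  rw [hN'] at hf
  refine mul_left_cancel₀ hg.ne' ?_
  linear_combination hf

/-- Pairing `c''` with the vertical unit vector: the vertical component of `c' × screwField` is
again `radialProduct`, so the terms in `z'` cancel. The right side is `H g'`, which integrates to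
the flux. -/
lemma IsCmcHelicoid.deriv_deriv_height (h : IsCmcHelicoid H l c) (u : ℝ) :
    deriv (deriv c) u 2 = 2 * H * radialProduct c u := by
  have hg := conformalFactor_pos h.smooth h.conformal u
  have := h.inner_deriv_deriv u !₂[0, 0, 1]
  simp only [inner_E3, cross, cross_apply, screwField] at this
  simp at this
  refine mul_left_cancel₀ hg.ne' ?_
  rw [this, radialProduct]
  ring

lemma IsCmcHelicoid.inner_deriv_deriv_radial (h : IsCmcHelicoid H l c) (u : ℝ) :
    c u 0 * deriv (deriv c) u 0 + c u 1 * deriv (deriv c) u 1 =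
      conformalFactor l c u - l ^ 2 - 2 * H * conformalFactor l c u * deriv c u 2 := by
  have hg := conformalFactor_pos h.smooth h.conformal u
  have h1 := isothermal_orthogonal h.smooth h.conformal u
  have h2 := isothermal_normSq h.smooth h.conformal u
  have h3 : conformalFactor l c u = c u 0 ^ 2 + c u 1 ^ 2 + l ^ 2 := rfl
  have := h.inner_deriv_deriv u !₂[c u 0, c u 1, 0]
  simp only [inner_E3, cross, cross_apply, screwField] at this
  simp [radialProduct] at this
  refine mul_left_cancel₀ hg.ne' ?_
  set g := conformalFactor l c u
  set d := deriv c u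
  have hrN : (d 1 * l - d 2 * c u 0) * c u 0 + (-(d 2 * c u 1) - d 0 * l) * c u 1 = -d 2 * g := by
    linear_combination l * h1 + d 2 * h3
  have hrd : (d 0 * c u 0 + d 1 * c u 1) * (c u 0 * d 0 + c u 1 * d 1) =
      (g - l ^ 2) * g - d 2 ^ 2 * g := by
    linear_combination (c u 0 ^ 2 + c u 1 ^ 2) * h2 - (g - d 2 ^ 2) * h3 -
      (c u 0 * d 1 - c u 1 * d 0 - l * d 2) * h1
  linear_combination this + hrd + (2 * H * g - d 2) * hrN

/-- The vertical flux of a cmc helicoid is constant. -/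
lemma IsCmcHelicoid.exists_flux (h : IsCmcHelicoid H l c) :
    ∃ a, ∀ u, deriv c u 2 = a + H * (conformalFactor l c u - l ^ 2) := by
  have hd : ∀ u, HasDerivAt (fun u => deriv c u 2 - H * conformalFactor l c u) 0 u := fun u =>
    ((hasDerivAt_deriv_coord h.smooth u 2).fun_sub
      ((hasDerivAt_conformalFactor (l := l) h.smooth u).const_mul H)).congr_deriv
      (by rw [h.deriv_deriv_height]; ring)
  refine ⟨deriv c 0 2 - H * conformalFactor l c 0 + H * l ^ 2, fun u => ?_⟩
  have := is_const_of_deriv_eq_zero (fun u => (hd u).differentiableAt)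
    (fun u => (hd u).deriv) u 0
  simp only at this
  linarith

/-- The conformal factor of a cmc helicoid is a profile; the parameters of the profile are related
by Vieta's formulas to the pitch and to the flux `a`. -/
lemma IsCmcHelicoid.exists_profile (h : IsCmcHelicoid H l c) (hH : H ≠ 0) :
    ∃ a m M, (∀ u, deriv c u 2 = a + H * (conformalFactor l c u - l ^ 2)) ∧
      H ^ 2 * (m * M) = l ^ 2 + (H * l ^ 2 - a) ^ 2 ∧
      H ^ 2 * (m + M) = 1 + 2 * H * (H * l ^ 2 - a) ∧
      IsConformalProfile H m M (conformalFactor l c) (fun u => 2 * radialProduct c u) := by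
  obtain ⟨a, ha⟩ := h.exists_flux
  have h1 := isothermal_orthogonal h.smooth h.conformal
  have h2 := isothermal_normSq h.smooth h.conformal
  have hg := conformalFactor_pos h.smooth h.conformal
  have hH2 : 0 < H ^ 2 := by positivity
  set q := H * l ^ 2 - a with hq
  -- Lagrange's identity in the horizontal plane, `(xx' + yy')² + (xy' - yx')² = (x² + y²)(x'² +
  -- y'²)`, with `xy' - yx' = -l z'` by orthogonality and `z'` given by the flux.
  have energy : ∀ u, (2 * radialProduct c u) ^ 2 = -4 * conformalFactor l c u *
      (H ^ 2 * conformalFactor l c u ^ 2 - (1 + 2 * H * q) * conformalFactor l c u +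
        (l ^ 2 + q ^ 2)) := fun u => by
    have h1 := h1 u
    have h2 := h2 u
    have h3 : conformalFactor l c u = c u 0 ^ 2 + c u 1 ^ 2 + l ^ 2 := rfl
    have hk := ha u
    rw [radialProduct]
    set g := conformalFactor l c u
    set d := deriv c u
    have hrd : (c u 0 * d 0 + c u 1 * d 1) ^ 2 =
        (g - l ^ 2) * g - d 2 ^ 2 * g := by
      linear_combination (c u 0 ^ 2 + c u 1 ^ 2) * h2 - (g - d 2 ^ 2) * h3 -
        (c u 0 * d 1 - c u 1 * d 0 - l * d 2) * h1
    rw [hk] at hrd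
    rw [hq]
    linear_combination 4 * hrd
  -- The left side of the energy identity is a square and `g > 0`, so the quadratic is nonpositive
  -- at `g 0` and has real roots.
  have hdisc : 0 ≤ (1 + 2 * H * q) ^ 2 - 4 * H ^ 2 * (l ^ 2 + q ^ 2) := by
    have e := energy 0
    have g0 := hg 0
    set g := conformalFactor l c 0
    have : H ^ 2 * g ^ 2 - (1 + 2 * H * q) * g + (l ^ 2 + q ^ 2) ≤ 0 := by
      by_contra! hcon
      have := mul_pos g0 hcon
      nlinarith [sq_nonneg (2 * radialProduct c 0)]
    nlinarith [sq_nonneg (2 * H ^ 2 * g - (1 + 2 * H * q))]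
  set r := √((1 + 2 * H * q) ^ 2 - 4 * H ^ 2 * (l ^ 2 + q ^ 2)) with hr
  have hr0 : 0 ≤ r := Real.sqrt_nonneg _
  have hr2 : r ^ 2 = (1 + 2 * H * q) ^ 2 - 4 * H ^ 2 * (l ^ 2 + q ^ 2) := Real.sq_sqrt hdisc
  obtain ⟨m, hm⟩ : ∃ m, m = (1 + 2 * H * q - r) / (2 * H ^ 2) := ⟨_, rfl⟩
  obtain ⟨M, hM⟩ : ∃ M, M = (1 + 2 * H * q + r) / (2 * H ^ 2) := ⟨_, rfl⟩
  have hprod : H ^ 2 * (m * M) = l ^ 2 + q ^ 2 := by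
    rw [hm, hM]; field_simp; linear_combination -hr2
  have hsum : H ^ 2 * (m + M) = 1 + 2 * H * q := by
    rw [hm, hM]; field_simp; ring
  have hle : m ≤ M := by
    rw [hm, hM]; gcongr; linarith
  have energy' : ∀ u, (2 * radialProduct c u) ^ 2 = -4 * H ^ 2 * conformalFactor l c u *
      ((conformalFactor l c u - m) * (conformalFactor l c u - M)) := fun u => by
    rw [energy]
    linear_combination (-4 * conformalFactor l c u ^ 2) * hsum +
      4 * conformalFactor l c u * hprod
  refine ⟨a, m, M, ha, hprod, hsum, ?_, hle, hg, hasDerivAt_conformalFactor h.smooth, ?_, energy'⟩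
  -- The roots have nonnegative product, and `M ≤ 0` would make the energy negative.
  · by_contra! hneg
    have hMp : 0 < M := by
      by_contra! hM0
      have g0 := hg 0
      have : 0 < H ^ 2 * conformalFactor l c 0 *
        ((conformalFactor l c 0 - m) * (conformalFactor l c 0 - M)) :=
        mul_pos (mul_pos hH2 g0) (mul_pos (by linarith) (by linarith))
      nlinarith [energy' 0, sq_nonneg (2 * radialProduct c 0)]
    have : m * M < 0 := mul_neg_of_neg_of_pos hneg hMp
    nlinarith [sq_nonneg l, sq_nonneg q]
  · intro u
    have hc := hasDerivAt_coord h.smooth u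
    have hd := hasDerivAt_deriv_coord h.smooth u
    refine ((((hc 0).fun_mul (hd 0)).fun_add ((hc 1).fun_mul (hd 1))).const_mul 2).congr_deriv ?_
    have h4 := h.inner_deriv_deriv_radial u
    have h2 := h2 u
    have hk := ha u
    have hk2 : deriv c u 2 = H * conformalFactor l c u - q := by rw [hk, hq]; ring
    rw [hk2] at h2 h4
    linear_combination 2 * h2 + 2 * h4 + (2 : ℝ) * hprod - 4 * conformalFactor l c u * hsum

end Cmc

/-! ### Solutions of the profile equation -/

lemma surjective_of_deriv_ge {f f' : ℝ → ℝ} {k : ℝ} (hk : 0 < k)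
    (hf : ∀ u, HasDerivAt f (f' u) u) (hf' : ∀ u, k ≤ f' u) : Function.Surjective f := by
  have hd : Differentiable ℝ f := fun u => (hf u).differentiableAt
  have key : ∀ u v, u ≤ v → k * (v - u) ≤ f v - f u := fun u v huv =>
    mul_sub_le_image_sub_of_le_deriv hd (fun u => by rw [(hf u).deriv]; exact hf' u) huv
  intro y
  refine mem_range_of_exists_le_of_exists_ge hd.continuous
    ⟨min 0 ((y - f 0) / k), ?_⟩ ⟨max 0 ((y - f 0) / k), ?_⟩
  · have h1 := key _ _ (min_le_left 0 ((y - f 0) / k))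
    have h2 := mul_le_mul_of_nonneg_left (min_le_right 0 ((y - f 0) / k)) hk.le
    rw [mul_div_cancel₀ _ hk.ne'] at h2
    linarith
  · have h1 := key _ _ (le_max_left 0 ((y - f 0) / k))
    have h2 := mul_le_mul_of_nonneg_left (le_max_right 0 ((y - f 0) / k)) hk.le
    rw [mul_div_cancel₀ _ hk.ne'] at h2
    linarith

namespace IsConformalProfile

variable {H m M : ℝ} {g g' : ℝ → ℝ}

lemma mem_Icc (h : IsConformalProfile H m M g g') (hH : H ≠ 0) (u : ℝ) :
    g u ∈ Set.Icc m M := by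
  have he := h.energy u
  have hg := h.pos u
  have hH2 : 0 < H ^ 2 := by positivity
  have hle := h.le
  have : (g u - m) * (g u - M) ≤ 0 := by
    by_contra! hc
    have := mul_pos (mul_pos hH2 hg) hc
    nlinarith [sq_nonneg (g' u)]
  constructor
  · by_contra! hc
    have := mul_pos_of_neg_of_neg (show g u - m < 0 by linarith) (show g u - M < 0 by linarith)
    linarith
  · by_contra! hc
    have := mul_pos (show 0 < g u - m by linarith) (show 0 < g u - M by linarith)
    linarith

lemma max_pos (h : IsConformalProfile H m M g g') (hH : H ≠ 0) : 0 < M :=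
  (h.pos 0).trans_le (h.mem_Icc hH 0).2

lemma continuous (h : IsConformalProfile H m M g g') : Continuous g :=
  continuous_iff_continuousAt.2 fun u => (h.hasDerivAt u).continuousAt

/-- The profile oscillates: `2 g - m - M = (M - m) cos (2 Θ + φ)` with `Θ' = |H| √g`. -/
lemma exists_phase (h : IsConformalProfile H m M g g') (hH : H ≠ 0) :
    ∃ (Θ : ℝ → ℝ) (φ : ℝ), (∀ u, HasDerivAt Θ (|H| * √(g u)) u) ∧
      ∀ u, 2 * g u - m - M = (M - m) * Real.cos (2 * Θ u + φ) := by
  have hcont : Continuous fun u => |H| * √(g u) :=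
    continuous_const.mul (Real.continuous_sqrt.comp h.continuous)
  have hκ : 0 < |H| := abs_pos.2 hH
  have hκ2 : |H| ^ 2 = H ^ 2 := sq_abs H
  set κ := |H|
  have hs : ∀ u, 0 < √(g u) := fun u => Real.sqrt_pos.2 (h.pos u)
  have hs2 : ∀ u, √(g u) ^ 2 = g u := fun u => Real.sq_sqrt (h.pos u).le
  let Θ : ℝ → ℝ := fun u => ∫ t in (0 : ℝ)..u, κ * √(g t)
  have hΘ : ∀ u, HasDerivAt Θ (κ * √(g u)) u := fun u =>
    hcont.integral_hasStrictDerivAt 0 u |>.hasDerivAt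
  have hΘ0 : Θ 0 = 0 := intervalIntegral.integral_same
  -- The point `(X, Y)` moves on the circle of radius `M - m` with angular speed `2 Θ'`; rotating it
  -- back by `2 Θ` gives the constants `hA` and `hB`.
  let X : ℝ → ℝ := fun u => 2 * g u - m - M
  let Y : ℝ → ℝ := fun u => -g' u / (κ * √(g u))
  have hX : ∀ u, HasDerivAt X (-(2 * (κ * √(g u))) * Y u) u := fun u => by
    refine ((((h.hasDerivAt u).const_mul 2).sub_const m).sub_const M).congr_deriv ?_
    have := hs u
    simp only [Y]
    field_simp
  have hY : ∀ u, HasDerivAt Y (2 * (κ * √(g u)) * X u) u := fun u => by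
    have := hs u
    refine ((h.hasDerivAt' u).fun_neg.fun_div (((h.hasDerivAt u).sqrt (h.pos u).ne').const_mul κ)
      (by positivity)).congr_deriv ?_
    have he := h.energy u
    have h2 := hs2 u
    simp only [X]
    rw [← hκ2] at he ⊢
    set s := √(g u)
    rw [← h2] at he ⊢
    field_simp
    field_simp at he
    linear_combination he
  have hc : ∀ u, HasDerivAt (fun u => Real.cos (2 * Θ u))
      (-Real.sin (2 * Θ u) * (2 * (κ * √(g u)))) u := fun u => ((hΘ u).const_mul 2).cos
  have hsn : ∀ u, HasDerivAt (fun u => Real.sin (2 * Θ u))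
      (Real.cos (2 * Θ u) * (2 * (κ * √(g u)))) u := fun u => ((hΘ u).const_mul 2).sin
  have hA : ∀ u, X u * Real.cos (2 * Θ u) + Y u * Real.sin (2 * Θ u) = X 0 := fun u => by
    have hd : ∀ u, HasDerivAt
        (fun u => X u * Real.cos (2 * Θ u) + Y u * Real.sin (2 * Θ u)) 0 u := fun u =>
      (((hX u).fun_mul (hc u)).fun_add ((hY u).fun_mul (hsn u))).congr_deriv (by ring)
    have := is_const_of_deriv_eq_zero (fun u => (hd u).differentiableAt)
      (fun u => (hd u).deriv) u 0
    simpa [hΘ0] using this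
  have hB : ∀ u, Y u * Real.cos (2 * Θ u) - X u * Real.sin (2 * Θ u) = Y 0 := fun u => by
    have hd : ∀ u, HasDerivAt
        (fun u => Y u * Real.cos (2 * Θ u) - X u * Real.sin (2 * Θ u)) 0 u := fun u =>
      (((hY u).fun_mul (hc u)).fun_sub ((hX u).fun_mul (hsn u))).congr_deriv (by ring)
    have := is_const_of_deriv_eq_zero (fun u => (hd u).differentiableAt)
      (fun u => (hd u).deriv) u 0
    simpa [hΘ0] using this
  have hd2 : X 0 ^ 2 + Y 0 ^ 2 = (M - m) ^ 2 := by
    have := hs 0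
    have he := h.energy 0
    have h2 := hs2 0
    simp only [X, Y]
    rw [div_pow, neg_sq, mul_pow, he, h2, hκ2]
    have := h.pos 0
    field_simp
    ring
  let z : ℂ := ⟨X 0, Y 0⟩
  have hz : ‖z‖ = M - m := by
    have h0 : 0 ≤ M - m := sub_nonneg.2 h.le
    rw [Complex.norm_def, Complex.normSq_mk, ← pow_two, ← pow_two, hd2, Real.sqrt_sq h0]
  have hzX : X 0 = (M - m) * Real.cos z.arg := by
    rw [← hz, Complex.norm_mul_cos_arg]
  have hzY : Y 0 = (M - m) * Real.sin z.arg := by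
    rw [← hz, Complex.norm_mul_sin_arg]
  refine ⟨Θ, z.arg, hΘ, fun u => ?_⟩
  change X u = _
  rw [Real.cos_add]
  have hA := hA u
  have hB := hB u
  rw [hzX] at hA
  rw [hzY] at hB
  linear_combination Real.cos (2 * Θ u) * hA - Real.sin (2 * Θ u) * hB -
    X u * Real.sin_sq_add_cos_sq (2 * Θ u)

/-- A positive lower bound for `g` bounds the phase speed `|H| √g` away from zero, so the phase runs
through all of `ℝ` and the cosine takes both values `±1`. -/
lemma exists_eq_of_pos_le (h : IsConformalProfile H m M g g') (hH : H ≠ 0) {b : ℝ}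
    (hb : 0 < b) (hbg : ∀ u, b ≤ g u) : (∃ u, g u = m) ∧ ∃ u, g u = M := by
  obtain ⟨Θ, φ, hΘ, hg⟩ := h.exists_phase hH
  have hsurj : Function.Surjective Θ :=
    surjective_of_deriv_ge (k := |H| * √b) (mul_pos (abs_pos.2 hH) (Real.sqrt_pos.2 hb)) hΘ
      fun u => mul_le_mul_of_nonneg_left (Real.sqrt_le_sqrt (hbg u)) (abs_nonneg H)
  constructor
  · obtain ⟨u, hu⟩ := hsurj ((Real.pi - φ) / 2)
    have := hg u
    rw [hu, show 2 * ((Real.pi - φ) / 2) + φ = Real.pi by ring, Real.cos_pi] at this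
    exact ⟨u, by linarith⟩
  · obtain ⟨u, hu⟩ := hsurj (-φ / 2)
    have := hg u
    rw [hu, show 2 * (-φ / 2) + φ = 0 by ring, Real.cos_zero] at this
    exact ⟨u, by linarith⟩

/-- Only an infimum: for `m = 0` it is not attained, because `g > 0`. A positive lower bound,
however, would force `g` to reach `m`. -/
lemma isGLB_range (h : IsConformalProfile H m M g g') (hH : H ≠ 0) : IsGLB (Set.range g) m := by
  refine ⟨by rintro _ ⟨u, rfl⟩; exact (h.mem_Icc hH u).1, fun b hb => ?_⟩
  have hb : ∀ u, b ≤ g u := fun u => hb ⟨u, rfl⟩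
  rcases le_or_gt b 0 with h0 | h0
  · exact h0.trans h.nonneg
  · obtain ⟨⟨u, hu⟩, -⟩ := h.exists_eq_of_pos_le hH h0 hb
    exact hu ▸ hb u

/-- The phase argument is unavailable here. The solutions are `M sech² (k (u - u₀))` with `k² = H²
M`, for which `T = (2kg - g') / (2kg + g')` is `exp (2k (u - u₀))`. At the point where `T = 1` the
derivative of `g` vanishes, and the energy identity gives `g = M`. -/
lemma exists_eq_max_of_zero (h : IsConformalProfile H 0 M g g') (hH : H ≠ 0) :
    ∃ u, g u = M := by
  have hM := h.max_pos hH
  obtain ⟨k, hk, hk2⟩ : ∃ k, 0 < k ∧ k ^ 2 = H ^ 2 * M := by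
    have : 0 < H ^ 2 * M := by positivity
    exact ⟨√(H ^ 2 * M), Real.sqrt_pos.2 this, Real.sq_sqrt this.le⟩
  have hlt : ∀ u, |g' u| < 2 * k * g u := fun u => by
    have hg := h.pos u
    refine abs_lt_of_sq_lt_sq ?_ (by positivity)
    rw [h.energy u, mul_pow, mul_pow, hk2]
    have : 0 < H ^ 2 * g u ^ 3 := by positivity
    linarith
  have hp : ∀ u, 0 < 2 * k * g u + g' u := fun u => by linarith [(abs_lt.1 (hlt u)).1]
  have hn : ∀ u, 0 < 2 * k * g u - g' u := fun u => by linarith [(abs_lt.1 (hlt u)).2]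
  let T : ℝ → ℝ := fun u => (2 * k * g u - g' u) / (2 * k * g u + g' u)
  have hT : ∀ u, HasDerivAt T (2 * k * T u) u := fun u => by
    have hpu := hp u
    have hd := (h.hasDerivAt u).const_mul (2 * k)
    refine ((hd.fun_sub (h.hasDerivAt' u)).fun_div (hd.fun_add (h.hasDerivAt' u))
      hpu.ne').congr_deriv ?_
    have he := h.energy u
    simp only [T]
    field_simp
    linear_combination 3 * k * he - 4 * k * g u ^ 2 * hk2
  have hc : ∀ u, T u * Real.exp (-(2 * k) * u) = T 0 := fun u => by
    have hd : ∀ u, HasDerivAt (fun u => T u * Real.exp (-(2 * k) * u)) 0 u := fun u =>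
      ((hT u).fun_mul ((hasDerivAt_id u).const_mul (-(2 * k))).exp).congr_deriv (by simp; ring)
    have := is_const_of_deriv_eq_zero (fun u => (hd u).differentiableAt)
      (fun u => (hd u).deriv) u 0
    simpa using this
  have hT0 : 0 < T 0 := div_pos (hn 0) (hp 0)
  refine ⟨-Real.log (T 0) / (2 * k), ?_⟩
  set u := -Real.log (T 0) / (2 * k) with hu
  have h1 := hc u
  rw [hu, show -(2 * k) * (-Real.log (T 0) / (2 * k)) = Real.log (T 0) by field_simp, ← hu,
    Real.exp_log hT0, mul_eq_right₀ hT0.ne'] at h1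
  have hpu := hp u
  have h2 : 2 * k * g u - g' u = 2 * k * g u + g' u := (div_eq_one_iff_eq hpu.ne').1 h1
  have h3 : g' u = 0 := by linarith
  have he := h.energy u
  rw [h3] at he
  have hg := h.pos u
  have h4 : (4 * H ^ 2 * g u * g u) * (g u - M) = 0 := by linear_combination he
  have := (mul_eq_zero.1 h4).resolve_left (by positivity)
  linarith

lemma exists_eq_max (h : IsConformalProfile H m M g g') (hH : H ≠ 0) : ∃ u, g u = M := by
  rcases h.nonneg.eq_or_lt with rfl | h0
  · exact h.exists_eq_max_of_zero hH
  · exact (h.exists_eq_of_pos_le hH h0 fun u => (h.mem_Icc hH u).1).2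

/-- The effect on the profile of pulling the metric back by `z ↦ μ z + b`; `H` is unchanged and the
ratio of the two roots is preserved. -/
lemma comp_affine (h : IsConformalProfile H m M g g') {μ : ℝ} (hμ : 0 < μ) (b : ℝ) :
    IsConformalProfile H (μ ^ 2 * m) (μ ^ 2 * M) (fun u => μ ^ 2 * g (μ * u + b))
      (fun u => μ ^ 3 * g' (μ * u + b)) where
  nonneg := mul_nonneg (sq_nonneg μ) h.nonneg
  le := mul_le_mul_of_nonneg_left h.le (sq_nonneg μ)
  pos u := mul_pos (by positivity) (h.pos _)
  hasDerivAt u := by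
    have ha : HasDerivAt (fun u => μ * u + b) μ u := by
      simpa using ((hasDerivAt_id u).const_mul μ).add_const b
    exact (((h.hasDerivAt _).comp u ha).const_mul (μ ^ 2)).congr_deriv (by ring)
  hasDerivAt' u := by
    have ha : HasDerivAt (fun u => μ * u + b) μ u := by
      simpa using ((hasDerivAt_id u).const_mul μ).add_const b
    exact (((h.hasDerivAt' _).comp u ha).const_mul (μ ^ 3)).congr_deriv (by ring)
  energy u := by
    rw [mul_pow, h.energy]
    ring

/-- The energy identity alone does not determine `g` past a turning point, so uniqueness is taken
from the second-order equation. As a system for `(g, g')` it is Lipschitz over the compact range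
`[m, M]`, and `g' = 0` at a maximum. -/
lemma eq_of_eq_max {g₁ g₁' g₂ g₂' : ℝ → ℝ} (h₁ : IsConformalProfile H m M g₁ g₁')
    (h₂ : IsConformalProfile H m M g₂ g₂') (hH : H ≠ 0) {u₀ : ℝ} (hu₁ : g₁ u₀ = M)
    (hu₂ : g₂ u₀ = M) : g₁ = g₂ := by
  let W : ℝ → ℝ := fun x => -2 * H ^ 2 * ((x - m) * (x - M) + x * (2 * x - m - M))
  have hW : ContDiff ℝ 1 W := by fun_prop
  obtain ⟨K, hK⟩ := hW.contDiffOn.exists_lipschitzOnWith (s := Set.Icc m M) one_ne_zero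
    (convex_Icc m M) isCompact_Icc
  have hlip : LipschitzOnWith (max 1 K) (fun y : ℝ × ℝ => (y.2, W y.1))
      (Set.Icc m M ×ˢ Set.univ) := by
    have h1 : LipschitzOnWith 1 (fun y : ℝ × ℝ => y.2) (Set.Icc m M ×ˢ Set.univ) :=
      LipschitzWith.prod_snd.lipschitzOnWith
    have h2 : LipschitzOnWith (K * 1) (W ∘ fun y : ℝ × ℝ => y.1) (Set.Icc m M ×ˢ Set.univ) :=
      hK.comp LipschitzWith.prod_fst.lipschitzOnWith fun y hy => hy.1
    rw [mul_one] at h2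
    exact h1.prodMk h2
  have hz : ∀ {g g' : ℝ → ℝ}, IsConformalProfile H m M g g' → g u₀ = M → g' u₀ = 0 := by
    intro g g' h hu
    have := h.energy u₀
    rw [hu, sub_self, mul_zero, mul_zero] at this
    exact pow_eq_zero_iff two_ne_zero |>.1 this
  have := ODE_solution_unique_univ (v := fun _ y => (y.2, W y.1)) (K := max 1 K)
    (s := fun _ => Set.Icc m M ×ˢ Set.univ) (f := fun u => (g₁ u, g₁' u))
    (g := fun u => (g₂ u, g₂' u)) (t₀ := u₀) (fun _ => hlip)
    (fun u => ⟨(h₁.hasDerivAt u).prodMk (h₁.hasDerivAt' u), h₁.mem_Icc hH u, trivial⟩)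
    (fun u => ⟨(h₂.hasDerivAt u).prodMk (h₂.hasDerivAt' u), h₂.mem_Icc hH u, trivial⟩)
    (by simp only [hu₁, hu₂, hz h₁ hu₁, hz h₂ hu₂])
  funext u
  exact congrArg Prod.fst (congrFun this u)

/-- The coefficient of `g` is `-2K`, since the metric `g |dz|²` has curvature `K = -(log g)'' /
(2g)`; thus `K = H² (1 - m M / g²)`. -/
lemma hasDerivAt_log_deriv (h : IsConformalProfile H m M g g') (u : ℝ) :
    HasDerivAt (fun u => g' u / g u) (2 * H ^ 2 * (m * M / g u ^ 2 - 1) * g u) u := by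
  have hg := h.pos u
  refine ((h.hasDerivAt' u).fun_div (h.hasDerivAt u) hg.ne').congr_deriv ?_
  have he := h.energy u
  field_simp
  linear_combination -he

end IsConformalProfile

/-! ### Isometric invariance of the curvature of a metric `g(u) (du ^ 2 + dv ^ 2)` -/

lemma eventually_add_ofReal_mul_mem {Ω : Set ℂ} (hΩ : IsOpen Ω) {z : ℂ} (hz : z ∈ Ω) (w : ℂ) :
    ∀ᶠ t : ℝ in nhds 0, z + t * w ∈ Ω := by
  have hc : Continuous fun t : ℝ => z + t * w := by fun_prop
  exact hc.continuousAt.eventually_mem (hΩ.mem_nhds (by simpa using hz))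

lemma hasDerivAt_line (z w : ℂ) : HasDerivAt (fun t : ℝ => z + t * w) w 0 := by
  simpa using ((Complex.ofRealCLM.hasDerivAt (x := (0 : ℝ))).mul_const w).const_add z

lemma hasDerivAt_comp_line {f : ℂ → ℂ} {f' z : ℂ} (hf : HasDerivAt f f' z) (w : ℂ) :
    HasDerivAt (fun t : ℝ => f (z + t * w)) (f' * w) 0 := by
  have h : HasDerivAt f f' (z + ((0 : ℝ) : ℂ) * w) := by simpa using hf
  exact HasDerivAt.comp (𝕜 := ℝ) (𝕜' := ℂ) 0 h (hasDerivAt_line z w)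

lemma hasDerivAt_re_comp_line {f : ℂ → ℂ} {f' z : ℂ} (hf : HasDerivAt f f' z) (w : ℂ) :
    HasDerivAt (fun t : ℝ => (f (z + t * w)).re) (f' * w).re 0 :=
  Complex.reCLM.hasFDerivAt.comp_hasDerivAt 0 (hasDerivAt_comp_line hf w)

lemma hasDerivAt_ofReal_comp_re_comp_line {a : ℝ → ℝ} {a' : ℝ} {f : ℂ → ℂ} {f' z : ℂ}
    (ha : HasDerivAt a a' (f z).re) (hf : HasDerivAt f f' z) (w : ℂ) :
    HasDerivAt (fun t : ℝ => ((a (f (z + t * w)).re : ℝ) : ℂ)) ((a' * (f' * w).re : ℝ) : ℂ) 0 := by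
  refine HasDerivAt.ofReal_comp ?_
  have h : HasDerivAt a a' (f (z + ((0 : ℝ) : ℂ) * w)).re := by simpa using ha
  exact h.comp 0 (hasDerivAt_re_comp_line hf w)

/-- The connection form of `g₁(u) |dz| ^ 2`, pulled back from `g₂` by a holomorphic isometry. -/
lemma connection_eq_of_holomorphic {g₁ g₁' g₂ g₂' : ℝ → ℝ} {F : ℂ → ℂ} {Ω : Set ℂ}
    (hg₁ : ∀ u, 0 < g₁ u) (hg₂ : ∀ u, 0 < g₂ u) (hd₁ : ∀ u, HasDerivAt g₁ (g₁' u) u)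
    (hd₂ : ∀ u, HasDerivAt g₂ (g₂' u) u) (hΩ : IsOpen Ω) (hF : DifferentiableOn ℂ F Ω)
    (hiso : ∀ z ∈ Ω, g₁ z.re = g₂ (F z).re * ‖deriv F z‖ ^ 2) {z : ℂ} (hz : z ∈ Ω) :
    ((g₁' z.re / g₁ z.re : ℝ) : ℂ) - ((g₂' (F z).re / g₂ (F z).re : ℝ) : ℂ) * deriv F z =
      2 * deriv (deriv F) z / deriv F z := by
  have hF1 : HasDerivAt F (deriv F z) z := (hF.differentiableAt (hΩ.mem_nhds hz)).hasDerivAt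
  have hF2 : HasDerivAt (deriv F) (deriv (deriv F) z) z :=
    ((hF.deriv hΩ).differentiableAt (hΩ.mem_nhds hz)).hasDerivAt
  have hN : 0 < ‖deriv F z‖ ^ 2 := by
    have h1 := hg₁ z.re
    rw [hiso z hz] at h1
    exact (mul_pos_iff_of_pos_left (hg₂ _)).1 h1
  have hF0 : deriv F z ≠ 0 := fun h => by simp [h] at hN
  -- The isometry relation differentiated in the direction `w`; the directions `1` and `i` together
  -- yield the complex identity.
  have key : ∀ w : ℂ, g₁' z.re * w.re = g₂' (F z).re * (deriv F z * w).re * ‖deriv F z‖ ^ 2 +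
      g₂ (F z).re * (2 * (starRingEnd ℂ (deriv F z) * (deriv (deriv F) z * w)).re) := fun w => by
    have h1 : HasDerivAt (fun t : ℝ => g₁ (z + t * w).re) (g₁' z.re * w.re) 0 := by
      have h : HasDerivAt g₁ (g₁' z.re) (z + ((0 : ℝ) : ℂ) * w).re := by simpa using hd₁ z.re
      simpa [Function.comp_def] using h.comp (0 : ℝ) (hasDerivAt_re_comp_line (hasDerivAt_id z) w)
    have h2 : HasDerivAt (fun t : ℝ => g₂ (F (z + t * w)).re)
        (g₂' (F z).re * (deriv F z * w).re) 0 := by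
      have h : HasDerivAt g₂ (g₂' (F z).re) (F (z + ((0 : ℝ) : ℂ) * w)).re := by
        simpa using hd₂ (F z).re
      exact h.comp (0 : ℝ) (hasDerivAt_re_comp_line hF1 w)
    have h3 := (hasDerivAt_comp_line hF2 w).norm_sq
    have h4 := (h2.fun_mul h3).congr_of_eventuallyEq
      ((eventually_add_ofReal_mul_mem hΩ hz w).mono fun t ht => hiso _ ht)
    have h5 := h1.unique h4
    simp only [Complex.inner, Complex.mul_re, Complex.conj_re, Complex.conj_im] at h5 ⊢
    simp only [zero_mul, add_zero, Complex.ofReal_zero] at h5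
    linear_combination h5
  set D := deriv F z with hD
  set D2 := deriv (deriv F) z
  rw [← Complex.normSq_eq_norm_sq, Complex.normSq_apply] at hN
  have hg := hiso z hz
  rw [← hD, ← Complex.normSq_eq_norm_sq, Complex.normSq_apply] at hg
  have k1 := key 1
  have k2 := key Complex.I
  rw [← Complex.normSq_eq_norm_sq, Complex.normSq_apply] at k1 k2
  simp at k1 k2
  have hg2 := hg₂ (F z).re
  have hg1 := hg₁ z.re
  rw [eq_div_iff hF0]
  obtain ⟨α, hα⟩ : ∃ α, α = g₁' z.re / g₁ z.re := ⟨_, rfl⟩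
  obtain ⟨β, hβ⟩ : ∃ β, β = g₂' (F z).re / g₂ (F z).re := ⟨_, rfl⟩
  rw [← hα, ← hβ]
  rw [eq_div_iff hg1.ne', hg] at hα
  rw [eq_div_iff hg2.ne'] at hβ
  rw [← hα, ← hβ] at k1
  rw [← hβ] at k2
  have hGN := mul_pos hg2 hN
  apply Complex.ext
  · simp
    refine mul_left_cancel₀ hGN.ne' ?_
    linear_combination D.re * k1 + D.im * k2
  · simp
    refine mul_left_cancel₀ hGN.ne' ?_
    linear_combination D.im * k1 - D.re * k2

/-- The connection identity has the holomorphic right side `2F'' / F'`, so the `∂/∂z̄` derivative of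
its left side vanishes. This reads `k₁ g₁ = k₂ g₂ |F'|²`, where `g₂ |F'|² = g₁`. -/
lemma curvature_eq_of_holomorphic {g₁ g₁' k₁ g₂ g₂' k₂ : ℝ → ℝ} {F : ℂ → ℂ} {Ω : Set ℂ}
    (hg₁ : ∀ u, 0 < g₁ u) (hg₂ : ∀ u, 0 < g₂ u) (hd₁ : ∀ u, HasDerivAt g₁ (g₁' u) u)
    (hd₂ : ∀ u, HasDerivAt g₂ (g₂' u) u)
    (hk₁ : ∀ u, HasDerivAt (fun u => g₁' u / g₁ u) (k₁ u * g₁ u) u)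
    (hk₂ : ∀ u, HasDerivAt (fun u => g₂' u / g₂ u) (k₂ u * g₂ u) u)
    (hΩ : IsOpen Ω) (hF : DifferentiableOn ℂ F Ω)
    (hiso : ∀ z ∈ Ω, g₁ z.re = g₂ (F z).re * ‖deriv F z‖ ^ 2) {z : ℂ} (hz : z ∈ Ω) :
    k₁ z.re = k₂ (F z).re := by
  have hF1 : HasDerivAt F (deriv F z) z := (hF.differentiableAt (hΩ.mem_nhds hz)).hasDerivAt
  have hF2 : HasDerivAt (deriv F) (deriv (deriv F) z) z :=
    ((hF.deriv hΩ).differentiableAt (hΩ.mem_nhds hz)).hasDerivAt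
  have hF3 : HasDerivAt (deriv (deriv F)) (deriv (deriv (deriv F)) z) z :=
    (((hF.deriv hΩ).deriv hΩ).differentiableAt (hΩ.mem_nhds hz)).hasDerivAt
  have hF0 : deriv F z ≠ 0 := fun h => by
    have := hg₁ z.re
    rw [hiso z hz, h] at this
    simp at this
  obtain ⟨κ, hκ⟩ : ∃ κ, HasDerivAt (fun z => 2 * deriv (deriv F) z / deriv F z) κ z :=
    ⟨_, (hF3.const_mul 2).fun_div hF2 hF0⟩
  have key : ∀ w : ℂ, ((k₁ z.re * g₁ z.re * w.re : ℝ) : ℂ) -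
      (((k₂ (F z).re * g₂ (F z).re * (deriv F z * w).re : ℝ) : ℂ) * deriv F z +
        ((g₂' (F z).re / g₂ (F z).re : ℝ) : ℂ) * (deriv (deriv F) z * w)) = κ * w := fun w => by
    have h1 := hasDerivAt_ofReal_comp_re_comp_line (hk₁ z.re) (hasDerivAt_id z) w
    have h2 := hasDerivAt_ofReal_comp_re_comp_line (hk₂ (F z).re) hF1 w
    have h3 := hasDerivAt_comp_line hF2 w
    have h4 := (h1.fun_sub (h2.fun_mul h3)).unique
      ((hasDerivAt_comp_line hκ w).congr_of_eventuallyEq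
        ((eventually_add_ofReal_mul_mem hΩ hz w).mono fun t ht =>
          connection_eq_of_holomorphic hg₁ hg₂ hd₁ hd₂ hΩ hF hiso ht))
    simpa using h4
  have k1 := key 1
  have k2 := key Complex.I
  have hg := hiso z hz
  rw [← Complex.normSq_eq_norm_sq, Complex.normSq_apply] at hg
  -- Complex linearity makes `i` times the derivative along `1` equal to the derivative along `i`;
  -- the imaginary part is the required relation.
  have h := congrArg (fun x => (Complex.I * x).im) k1
  have h' := congrArg Complex.im k2
  simp at h h'
  have : (k₁ z.re - k₂ (F z).re) * g₁ z.re = 0 := by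
    linear_combination h - h' - k₂ (F z).re * hg
  have := (mul_eq_zero.1 this).resolve_right (hg₁ z.re).ne'
  linarith

/-- A change of parameters that pulls `g₂ |dw| ^ 2` back to `g₁ |dz| ^ 2` is holomorphic, up to a
reflection of the plane. -/
lemma exists_holomorphic_of_isometry {g₁ g₂ : ℝ → ℝ} {Φ : ℝ × ℝ → ℝ × ℝ} {U : Set (ℝ × ℝ)}
    (hg₁ : ∀ u, 0 < g₁ u) (hg₂ : ∀ u, 0 < g₂ u) (hU : IsOpen U) (hΦ : ContDiffOn ℝ ∞ Φ U)
    (hiso : ∀ q ∈ U, ∀ ξ η, g₂ (Φ q).1 * ((fderiv ℝ Φ q ξ).1 * (fderiv ℝ Φ q η).1 +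
      (fderiv ℝ Φ q ξ).2 * (fderiv ℝ Φ q η).2) = g₁ q.1 * (ξ.1 * η.1 + ξ.2 * η.2))
    {p : ℝ × ℝ} (hp : p ∈ U) :
    ∃ (F : ℂ → ℂ) (Ω : Set ℂ) (z : ℂ), IsOpen Ω ∧ z ∈ Ω ∧ DifferentiableOn ℂ F Ω ∧
      z.re = p.1 ∧ (F z).re = (Φ p).1 ∧ ∀ z ∈ Ω, g₁ z.re = g₂ (F z).re * ‖deriv F z‖ ^ 2 := by
  let J : ℝ × ℝ → ℝ := fun q => (fderiv ℝ Φ q (1, 0)).1 * (fderiv ℝ Φ q (0, 1)).2 -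
    (fderiv ℝ Φ q (0, 1)).1 * (fderiv ℝ Φ q (1, 0)).2
  have hJc : ContinuousOn J U := by
    have h := hΦ.continuousOn_fderiv_of_isOpen hU (by simp)
    have h1 := h.clm_apply (continuousOn_const (c := ((1 : ℝ), (0 : ℝ))))
    have h2 := h.clm_apply (continuousOn_const (c := ((0 : ℝ), (1 : ℝ))))
    exact (h1.fst.mul h2.snd).sub (h2.fst.mul h1.snd)
  have hJ2 : ∀ q ∈ U, J q ^ 2 * g₂ (Φ q).1 ^ 2 = g₁ q.1 ^ 2 := fun q hq => by
    have e1 := hiso q hq (1, 0) (1, 0)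
    have e2 := hiso q hq (0, 1) (0, 1)
    have e3 := hiso q hq (1, 0) (0, 1)
    simp at e1 e2 e3
    have := (hg₂ (Φ q).1).ne'
    replace e3 := e3.resolve_left this
    simp only [J]
    set A := fderiv ℝ Φ q (1, 0)
    set B := fderiv ℝ Φ q (0, 1)
    set G := g₂ (Φ q).1
    linear_combination (G * (B.1 * B.1 + B.2 * B.2)) * e1 + g₁ q.1 * e2 -
      G ^ 2 * (A.1 * B.1 + A.2 * B.2) * e3
  -- `σ` is the sign of the Jacobian at `p`. Precomposing with `(u, v) ↦ (u, σ v)` makes the map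
  -- orientation preserving near `p` and leaves `g₁(u) |dz|²` unchanged.
  obtain ⟨σ, hσ, hσJ⟩ : ∃ σ : ℝ, σ * σ = 1 ∧ 0 < σ * J p := by
    have h0 : J p ≠ 0 := fun h => by
      have := hJ2 p hp
      rw [h] at this
      have := hg₁ p.1
      nlinarith
    rcases h0.lt_or_gt with h | h
    · exact ⟨-1, by norm_num, by linarith⟩
    · exact ⟨1, by norm_num, by linarith⟩
  let ψ : ℂ →L[ℝ] ℝ × ℝ := Complex.reCLM.prod (σ • Complex.imCLM)
  let e : ℝ × ℝ →L[ℝ] ℂ := (Complex.equivRealProdCLM.symm : ℝ × ℝ →L[ℝ] ℂ)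
  obtain ⟨V, hV, hVo, hpV⟩ : ∃ V ⊆ {q | q ∈ U ∧ 0 < σ * J q}, IsOpen V ∧ p ∈ V :=
    mem_nhds_iff.1 (Filter.inter_mem (hU.mem_nhds hp)
      ((continuousAt_const.mul (hJc.continuousAt (hU.mem_nhds hp))).eventually_const_lt hσJ))
  have hψ1 : ψ 1 = (1, 0) := by simp [ψ]
  have hψI : ψ Complex.I = σ • (0, 1) := by simp [ψ]
  have hF : ∀ z ∈ ψ ⁻¹' V, HasFDerivAt (fun z => e (Φ (ψ z)))
      ((e.comp (fderiv ℝ Φ (ψ z))).comp ψ) z := fun z hz => by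
    have h := ((hΦ.contDiffAt (hU.mem_nhds (hV hz).1)).differentiableAt (by simp)).hasFDerivAt
    exact (e.hasFDerivAt.comp _ h).comp z ψ.hasFDerivAt
  have hCR : ∀ z ∈ ψ ⁻¹' V, ((e.comp (fderiv ℝ Φ (ψ z))).comp ψ) Complex.I =
      Complex.I • ((e.comp (fderiv ℝ Φ (ψ z))).comp ψ) 1 := fun z hz => by
    have hq := hV hz
    set q := ψ z
    have e1 := hiso q hq.1 (1, 0) (1, 0)
    have e2 := hiso q hq.1 (0, 1) (0, 1)
    have e3 := hJ2 q hq.1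
    have e4 := hq.2
    simp only [ContinuousLinearMap.comp_apply, hψ1, hψI, map_smul]
    simp at e1 e2
    simp only [J] at e3 e4
    set A := fderiv ℝ Φ q (1, 0)
    set B := fderiv ℝ Φ q (0, 1)
    have hG := hg₂ (Φ q).1
    set G := g₂ (Φ q).1
    have e5 : σ * (A.1 * B.2 - B.1 * A.2) * G = g₁ q.1 := by
      refine (sq_eq_sq₀ (mul_pos e4 hG).le (hg₁ _).le).1 ?_
      linear_combination e3 + (A.1 * B.2 - B.1 * A.2) ^ 2 * G ^ 2 * hσ
    -- The sum of squares equals `|A|² + |B|² - 2σJ`, and each of `|A|²`, `|B|²`, `σJ` is `g₁ / G`.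
    -- Its vanishing is the Cauchy–Riemann system.
    have e6 : (σ * B.2 - A.1) ^ 2 + (σ * B.1 + A.2) ^ 2 = 0 := by
      refine mul_left_cancel₀ hG.ne' ?_
      linear_combination e1 + e2 - 2 * e5 + G * (B.1 ^ 2 + B.2 ^ 2) * hσ
    have e7 : σ * B.2 - A.1 = 0 := by
      nlinarith [sq_nonneg (σ * B.2 - A.1), sq_nonneg (σ * B.1 + A.2)]
    have e8 : σ * B.1 + A.2 = 0 := by
      nlinarith [sq_nonneg (σ * B.2 - A.1), sq_nonneg (σ * B.1 + A.2)]
    apply Complex.ext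
    · simp [e]; linarith
    · simp [e]; linarith
  refine ⟨fun z => e (Φ (ψ z)), ψ ⁻¹' V, ⟨p.1, σ * p.2⟩, hVo.preimage ψ.continuous, ?_,
    fun z hz => ?_, rfl, ?_, fun z hz => ?_⟩
  · have : ψ ⟨p.1, σ * p.2⟩ = p := by
      ext <;> simp [ψ, ← mul_assoc, hσ]
    simpa [this] using hpV
  · exact ((hF z hz).complexOfReal_hasFDerivAt (hCR z hz)).differentiableAt.differentiableWithinAt
  · have : ψ ⟨p.1, σ * p.2⟩ = p := by
      ext <;> simp [ψ, ← mul_assoc, hσ]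
    simp [this, e]
  · have hd := ((hF z hz).complexOfReal_hasFDerivAt (hCR z hz)).hasDerivAt.deriv
    have e1 := hiso (ψ z) (hV hz).1 (1, 0) (1, 0)
    rw [hd, ← Complex.normSq_eq_norm_sq, Complex.normSq_apply]
    simp [hψ1, e]
    simp at e1
    rw [e1]
    simp [ψ]

/-- **Theorema egregium** for metrics `g(u) (du ^ 2 + dv ^ 2)`. -/
lemma curvature_eq_of_isometry {g₁ g₁' k₁ g₂ g₂' k₂ : ℝ → ℝ} {Φ : ℝ × ℝ → ℝ × ℝ}
    {U : Set (ℝ × ℝ)} (hg₁ : ∀ u, 0 < g₁ u) (hg₂ : ∀ u, 0 < g₂ u)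
    (hd₁ : ∀ u, HasDerivAt g₁ (g₁' u) u) (hd₂ : ∀ u, HasDerivAt g₂ (g₂' u) u)
    (hk₁ : ∀ u, HasDerivAt (fun u => g₁' u / g₁ u) (k₁ u * g₁ u) u)
    (hk₂ : ∀ u, HasDerivAt (fun u => g₂' u / g₂ u) (k₂ u * g₂ u) u)
    (hU : IsOpen U) (hΦ : ContDiffOn ℝ ∞ Φ U)
    (hiso : ∀ q ∈ U, ∀ ξ η, g₂ (Φ q).1 * ((fderiv ℝ Φ q ξ).1 * (fderiv ℝ Φ q η).1 +
      (fderiv ℝ Φ q ξ).2 * (fderiv ℝ Φ q η).2) = g₁ q.1 * (ξ.1 * η.1 + ξ.2 * η.2))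
    {p : ℝ × ℝ} (hp : p ∈ U) : k₁ p.1 = k₂ (Φ p).1 := by
  obtain ⟨F, Ω, z, hΩ, hz, hF, hz1, hFz, hg⟩ :=
    exists_holomorphic_of_isometry hg₁ hg₂ hU hΦ hiso hp
  rw [← hz1, ← hFz]
  exact curvature_eq_of_holomorphic hg₁ hg₂ hd₁ hd₂ hk₁ hk₂ hΩ hF hg hz

/-! ### Radii, local isometries and associated families of cmc helicoids -/

lemma axisDist_helicoidalSurface (l : ℝ) (c : ℝ → E3) (p : ℝ × ℝ) :
    axisDist (helicoidalSurface l c p) = √(conformalFactor l c p.1 - l ^ 2) := by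
  rw [axisDist]
  congr 1
  simp [helicoidalSurface, helicoidalMotion, conformalFactor]
  linear_combination (c p.1 0 ^ 2 + c p.1 1 ^ 2) * Real.sin_sq_add_cos_sq p.2

section Radii

variable {H l m M : ℝ} {c : ℝ → E3} {g' : ℝ → ℝ}

lemma IsConformalProfile.sq_le (h : IsConformalProfile H m M (conformalFactor l c) g')
    (hH : H ≠ 0) : l ^ 2 ≤ m :=
  (h.isGLB_range hH).2 (by rintro _ ⟨u, rfl⟩; exact le_add_of_nonneg_left (by positivity))

lemma IsConformalProfile.innerRadius_eq (h : IsConformalProfile H m M (conformalFactor l c) g')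
    (hH : H ≠ 0) : innerRadius (helicoidalSurface l c) = √(m - l ^ 2) := by
  refine IsGLB.csInf_eq ⟨?_, fun b hb => ?_⟩ (Set.range_nonempty _)
  · rintro _ ⟨p, rfl⟩
    simp only [axisDist_helicoidalSurface]
    exact Real.sqrt_le_sqrt (sub_le_sub_right (h.mem_Icc hH _).1 _)
  · rcases le_or_gt b 0 with h0 | h0
    · exact h0.trans (Real.sqrt_nonneg _)
    · refine Real.le_sqrt_of_sq_le (le_sub_iff_add_le.2 ((h.isGLB_range hH).2 ?_))
      rintro _ ⟨u, rfl⟩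
      have := hb ⟨(u, 0), rfl⟩
      simp only [axisDist_helicoidalSurface] at this
      linarith [(Real.le_sqrt' h0).1 this]

lemma IsConformalProfile.outerRadius_eq (h : IsConformalProfile H m M (conformalFactor l c) g')
    (hH : H ≠ 0) : outerRadius (helicoidalSurface l c) = √(M - l ^ 2) := by
  refine IsGreatest.csSup_eq ⟨?_, ?_⟩
  · obtain ⟨u, hu⟩ := h.exists_eq_max hH
    exact ⟨(u, 0), by simp only [axisDist_helicoidalSurface, hu]⟩
  · rintro _ ⟨p, rfl⟩
    simp only [axisDist_helicoidalSurface]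
    exact Real.sqrt_le_sqrt (sub_le_sub_right (h.mem_Icc hH _).2 _)

lemma IsConformalProfile.sq_add_innerRadius_sq
    (h : IsConformalProfile H m M (conformalFactor l c) g') (hH : H ≠ 0) :
    l ^ 2 + innerRadius (helicoidalSurface l c) ^ 2 = m := by
  rw [h.innerRadius_eq hH, Real.sq_sqrt (sub_nonneg.2 (h.sq_le hH))]
  ring

lemma IsConformalProfile.sq_add_outerRadius_sq
    (h : IsConformalProfile H m M (conformalFactor l c) g') (hH : H ≠ 0) :
    l ^ 2 + outerRadius (helicoidalSurface l c) ^ 2 = M := by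
  rw [h.outerRadius_eq hH, Real.sq_sqrt (sub_nonneg.2 ((h.sq_le hH).trans h.le))]
  ring

end Radii

/-- The product relation gives `H ρ R = ±a`; inserted in the sum relation, it completes a square,
`H² (R ± ρ)² = 1`. -/
lemma sq_eq_sq_sub_inv_abs {H a ρ R : ℝ} (hH : H ≠ 0) (hρ : 0 ≤ ρ) (hle : ρ ≤ R)
    (hprod : H ^ 2 * (ρ ^ 2 * R ^ 2) = a ^ 2) (hsum : H ^ 2 * (ρ ^ 2 + R ^ 2) = 1 - 2 * H * a) :
    ρ ^ 2 = (R - 1 / |H|) ^ 2 := by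
  have hκ : 0 < |H| := abs_pos.2 hH
  have hκ2 : |H| ^ 2 = H ^ 2 := sq_abs H
  have hRρ : 0 ≤ R * ρ := mul_nonneg (hρ.trans hle) hρ
  have h1 : (H * (H * (ρ * R)) - H * a) * (H * (H * (ρ * R)) + H * a) = 0 := by
    linear_combination H ^ 2 * hprod
  have h2 : |H| * (R + ρ) = 1 ∨ |H| * (R - ρ) = 1 := by
    rcases mul_eq_zero.1 h1 with h | h
    · refine Or.inl ((sq_eq_sq₀ (by nlinarith) zero_le_one).1 ?_)
      rw [mul_pow, hκ2]
      linear_combination hsum + 2 * h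
    · refine Or.inr ((sq_eq_sq₀ (mul_nonneg hκ.le (sub_nonneg.2 hle)) zero_le_one).1 ?_)
      rw [mul_pow, hκ2]
      linear_combination hsum - 2 * h
  rcases h2 with h | h <;> rw [← h] <;> field_simp <;> ring

/-- The radii of a cmc helicoid satisfy `ρ + R = 1 / |H|` or `R - ρ = 1 / |H|`. -/
lemma IsCmcHelicoid.innerRadius_sq {H l : ℝ} {c : ℝ → E3} (h : IsCmcHelicoid H l c)
    (hH : H ≠ 0) : innerRadius (helicoidalSurface l c) ^ 2 =
      (outerRadius (helicoidalSurface l c) - 1 / |H|) ^ 2 := by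
  obtain ⟨a, m, M, -, hprod, hsum, hp⟩ := h.exists_profile hH
  have hm := hp.sq_add_innerRadius_sq hH
  have hM := hp.sq_add_outerRadius_sq hH
  have hρ : 0 ≤ innerRadius (helicoidalSurface l c) := by
    rw [hp.innerRadius_eq hH]; exact Real.sqrt_nonneg _
  have hle : innerRadius (helicoidalSurface l c) ≤ outerRadius (helicoidalSurface l c) := by
    rw [hp.innerRadius_eq hH, hp.outerRadius_eq hH]
    exact Real.sqrt_le_sqrt (sub_le_sub_right hp.le _)
  set ρ := innerRadius (helicoidalSurface l c)
  set R := outerRadius (helicoidalSurface l c)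
  rw [← hm, ← hM] at hprod hsum
  -- Subtracting `l²` times the sum relation from the product relation removes the pitch.
  exact sq_eq_sq_sub_inv_abs hH hρ hle (a := a) (by linear_combination hprod - l ^ 2 * hsum)
    (by linear_combination hsum)

lemma SameAssociatedFamily.locallyIsometric {x₁ x₂ : ℝ × ℝ → E3}
    (h : SameAssociatedFamily x₁ x₂) : LocallyIsometric x₁ x₂ := by
  obtain ⟨Φ, θ, hΦ, hΦ', h⟩ := h
  refine ⟨fun p => ⟨Set.univ, Φ, isOpen_univ, trivial, hΦ.contDiffOn, fun q _ => (h q).2.1⟩,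
    fun p => ⟨Set.univ, Φ.symm, isOpen_univ, trivial, hΦ'.contDiffOn, fun q _ ξ η => ?_⟩⟩
  have hd : ∀ ξ, fderiv ℝ Φ (Φ.symm q) (fderiv ℝ Φ.symm q ξ) = ξ := fun ξ => by
    have h1 := ((hΦ.differentiable (by simp)) (Φ.symm q)).hasFDerivAt.comp q
      ((hΦ'.differentiable (by simp)) q).hasFDerivAt
    rw [Φ.self_comp_symm] at h1
    exact congrArg (fun f => f ξ) (h1.unique (hasFDerivAt_id q))
  have := (h (Φ.symm q)).2.1 (fderiv ℝ Φ.symm q ξ) (fderiv ℝ Φ.symm q η)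
  rw [← this, hd, hd, Φ.apply_symm_apply]

/-! ### The ratio `m / M` as a complete invariant -/

section Ratio

variable {H l₁ l₂ m₁ M₁ m₂ M₂ : ℝ} {c₁ c₂ : ℝ → E3} {g₁' g₂' : ℝ → ℝ}

/-- Curvatures are compared at a point where the first profile attains `M₁`: there `m₁ / M₁ = m₂ M₂
/ g₂²` at the image point, and `g₂ ≤ M₂`. Only an inequality results, as the image need not be known
to be a maximum; the reverse isometries supply the other one. -/
lemma IsConformalProfile.ratio_le_of_locallyIsometricInto (hH : H ≠ 0)
    (h₁ : IsCmcHelicoid H l₁ c₁) (h₂ : IsCmcHelicoid H l₂ c₂)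
    (hp₁ : IsConformalProfile H m₁ M₁ (conformalFactor l₁ c₁) g₁')
    (hp₂ : IsConformalProfile H m₂ M₂ (conformalFactor l₂ c₂) g₂')
    (h : LocallyIsometricInto (helicoidalSurface l₁ c₁) (helicoidalSurface l₂ c₂)) :
    m₂ / M₂ ≤ m₁ / M₁ := by
  obtain ⟨u, hu⟩ := hp₁.exists_eq_max hH
  obtain ⟨U, Φ, hU, hpU, hΦ, hiso⟩ := h (u, 0)
  have hk := curvature_eq_of_isometry hp₁.pos hp₂.pos hp₁.hasDerivAt hp₂.hasDerivAt
    hp₁.hasDerivAt_log_deriv hp₂.hasDerivAt_log_deriv hU hΦ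
    (fun q hq ξ η => by
      have := hiso q hq ξ η
      rwa [firstForm_eq h₁.smooth h₁.conformal, firstForm_eq h₂.smooth h₂.conformal] at this) hpU
  have hH2 : 2 * H ^ 2 ≠ 0 := by positivity
  have hk := mul_left_cancel₀ hH2 hk
  simp only [hu] at hk
  have hM₁ := hp₁.max_pos hH
  have hM₂ := hp₂.max_pos hH
  have hg := hp₂.pos (Φ (u, 0)).1
  have hle := (hp₂.mem_Icc hH (Φ (u, 0)).1).2
  calc m₂ / M₂ = m₂ * M₂ / M₂ ^ 2 := by field_simp
    _ ≤ m₂ * M₂ / conformalFactor l₂ c₂ (Φ (u, 0)).1 ^ 2 := by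
      have := mul_nonneg hp₂.nonneg hM₂.le
      gcongr
    _ = m₁ * M₁ / M₁ ^ 2 := by linarith
    _ = m₁ / M₁ := by field_simp

/-- `(L - N) / 2 = Hg - z'`, and the flux relation cancels `g`, leaving a constant coefficient. -/
lemma hopfDifferential_eq {H l a : ℝ} {c : ℝ → E3} (h : IsCmcHelicoid H l c)
    (ha : ∀ u, deriv c u 2 = a + H * (conformalFactor l c u - l ^ 2)) (p ξ : ℝ × ℝ) :
    hopfDifferential (helicoidalSurface l c) p ξ =
      ⟨H * l ^ 2 - a, l⟩ * ((ξ.1 : ℂ) + Complex.I * (ξ.2 : ℂ)) ^ 2 := by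
  rw [hopfDifferential, h.secondForm_fst_fst, secondForm_snd_snd h.smooth h.conformal,
    secondForm_fst_snd h.smooth h.conformal, ha]
  congr 1
  apply Complex.ext
  · simp [-Complex.ofReal_pow]; ring
  · simp [-Complex.ofReal_pow]

lemma exists_phase_of_norm_eq {z w : ℂ} (h : ‖z‖ = ‖w‖) :
    ∃ θ : ℝ, w = Complex.exp (θ * Complex.I) * z := by
  refine ⟨w.arg - z.arg, ?_⟩
  calc w = ‖w‖ * Complex.exp (w.arg * Complex.I) := (Complex.norm_mul_exp_arg_mul_I w).symm
    _ = Complex.exp (((w.arg - z.arg : ℝ) : ℂ) * Complex.I) *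
        (‖z‖ * Complex.exp (z.arg * Complex.I)) := by
      rw [mul_left_comm, ← Complex.exp_add, h]
      push_cast
      ring_nf
    _ = _ := by rw [Complex.norm_mul_exp_arg_mul_I]

/-- The similarity `z ↦ μ z + b` of the parameter plane. -/
def scaleShift (μ b : ℝ) (hμ : μ ≠ 0) : ℝ × ℝ ≃ ℝ × ℝ where
  toFun p := (μ * p.1 + b, μ * p.2)
  invFun p := (μ⁻¹ * (p.1 - b), μ⁻¹ * p.2)
  left_inv p := by ext <;> simp [hμ]
  right_inv p := by ext <;> simp [hμ]

lemma fderiv_scaleShift (μ b : ℝ) (hμ : μ ≠ 0) (p : ℝ × ℝ) :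
    fderiv ℝ (scaleShift μ b hμ) p = μ • ContinuousLinearMap.id ℝ (ℝ × ℝ) := by
  have h : HasFDerivAt (fun p : ℝ × ℝ => μ • p + (b, 0))
      (μ • ContinuousLinearMap.id ℝ (ℝ × ℝ)) p :=
    ((hasFDerivAt_id p).const_smul μ).add_const (b, 0)
  have : ⇑(scaleShift μ b hμ) = fun p : ℝ × ℝ => μ • p + (b, 0) := by
    funext p
    ext <;> simp [scaleShift]
  rw [this, h.fderiv]

/-- The parameter change is `z ↦ μ z + b`, with `μ² = M₁ / M₂` to match the roots and `b` chosen to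
align a maximum of each profile. It multiplies the second Hopf coefficient by `μ²`, and `hq₁`, `hq₂`
then show that the moduli agree. -/
lemma sameAssociatedFamily_of_ratio_eq {a₁ a₂ : ℝ} (hH : H ≠ 0)
    (h₁ : IsCmcHelicoid H l₁ c₁) (h₂ : IsCmcHelicoid H l₂ c₂)
    (ha₁ : ∀ u, deriv c₁ u 2 = a₁ + H * (conformalFactor l₁ c₁ u - l₁ ^ 2))
    (ha₂ : ∀ u, deriv c₂ u 2 = a₂ + H * (conformalFactor l₂ c₂ u - l₂ ^ 2))
    (hq₁ : H ^ 2 * (m₁ * M₁) = l₁ ^ 2 + (H * l₁ ^ 2 - a₁) ^ 2)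
    (hq₂ : H ^ 2 * (m₂ * M₂) = l₂ ^ 2 + (H * l₂ ^ 2 - a₂) ^ 2)
    (hp₁ : IsConformalProfile H m₁ M₁ (conformalFactor l₁ c₁) g₁')
    (hp₂ : IsConformalProfile H m₂ M₂ (conformalFactor l₂ c₂) g₂')
    (h : m₁ / M₁ = m₂ / M₂) :
    SameAssociatedFamily (helicoidalSurface l₁ c₁) (helicoidalSurface l₂ c₂) := by
  have hM₁ := hp₁.max_pos hH
  have hM₂ := hp₂.max_pos hH
  obtain ⟨μ, hμ, hμ2⟩ : ∃ μ, 0 < μ ∧ μ ^ 2 = M₁ / M₂ :=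
    ⟨√(M₁ / M₂), Real.sqrt_pos.2 (div_pos hM₁ hM₂), Real.sq_sqrt (div_pos hM₁ hM₂).le⟩
  have hM : M₁ = μ ^ 2 * M₂ := by rw [hμ2]; field_simp
  have hm : m₁ = μ ^ 2 * m₂ := by
    rw [div_eq_div_iff hM₁.ne' hM₂.ne', hM] at h
    refine mul_right_cancel₀ hM₂.ne' ?_
    linear_combination h
  obtain ⟨u₁, hu₁⟩ := hp₁.exists_eq_max hH
  obtain ⟨u₂, hu₂⟩ := hp₂.exists_eq_max hH
  have hs := hp₂.comp_affine hμ (u₂ - μ * u₁)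
  rw [← hm, ← hM] at hs
  have hg := hp₁.eq_of_eq_max hs hH hu₁ (by
    rw [show μ * u₁ + (u₂ - μ * u₁) = u₂ by ring, hu₂, hM])
  have hnorm : ‖(⟨H * l₁ ^ 2 - a₁, l₁⟩ : ℂ)‖ = ‖(μ : ℂ) ^ 2 * ⟨H * l₂ ^ 2 - a₂, l₂⟩‖ := by
    refine (sq_eq_sq₀ (norm_nonneg _) (norm_nonneg _)).1 ?_
    rw [norm_mul, norm_pow, Complex.norm_real, Real.norm_eq_abs, sq_abs, mul_pow,
      ← Complex.normSq_eq_norm_sq, ← Complex.normSq_eq_norm_sq, Complex.normSq_mk,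
      Complex.normSq_mk]
    rw [hm, hM] at hq₁
    linear_combination -hq₁ + μ ^ 4 * hq₂
  obtain ⟨θ, hθ⟩ := exists_phase_of_norm_eq hnorm
  refine ⟨scaleShift μ (u₂ - μ * u₁) hμ.ne', θ, ?_, ?_, fun p => ⟨?_, fun ξ η => ?_, ?_,
    fun ξ => ?_⟩⟩
  · change ContDiff ℝ ∞ fun p : ℝ × ℝ => (μ * p.1 + (u₂ - μ * u₁), μ * p.2)
    fun_prop
  · change ContDiff ℝ ∞ fun p : ℝ × ℝ => (μ⁻¹ * (p.1 - (u₂ - μ * u₁)), μ⁻¹ * p.2)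
    fun_prop
  · rw [fderiv_scaleShift, ContinuousLinearMap.det]
    simp [LinearMap.det_smul]
    positivity
  · rw [fderiv_scaleShift, firstForm_eq h₁.smooth h₁.conformal,
      firstForm_eq h₂.smooth h₂.conformal, congrFun hg p.1]
    simp [scaleShift]
    ring
  · rw [h₁.cmc, h₂.cmc]
  · rw [fderiv_scaleShift, hopfDifferential_eq h₁ ha₁, hopfDifferential_eq h₂ ha₂, ← mul_assoc,
      ← hθ]
    simp
    ring

end Ratio

end

theorem theorem6p12 (H : ℝ) (hH : H ≠ 0) (l₁ l₂ : ℝ) (c₁ c₂ : ℝ → E3)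
    (h₁ : IsCmcHelicoid H l₁ c₁) (h₂ : IsCmcHelicoid H l₂ c₂) (ρ₁ R₁ ρ₂ R₂ : ℝ)
    (hρ₁ : ρ₁ = innerRadius (helicoidalSurface l₁ c₁))
    (hR₁ : R₁ = outerRadius (helicoidalSurface l₁ c₁))
    (hρ₂ : ρ₂ = innerRadius (helicoidalSurface l₂ c₂))
    (hR₂ : R₂ = outerRadius (helicoidalSurface l₂ c₂)) :
    (SameAssociatedFamily (helicoidalSurface l₁ c₁) (helicoidalSurface l₂ c₂) ↔
      (l₁ ^ 2 + ρ₁ ^ 2) / (l₁ ^ 2 + R₁ ^ 2) = (l₂ ^ 2 + ρ₂ ^ 2) / (l₂ ^ 2 + R₂ ^ 2)) ∧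
    (LocallyIsometric (helicoidalSurface l₁ c₁) (helicoidalSurface l₂ c₂) ↔
      (l₁ ^ 2 + ρ₁ ^ 2) / (l₁ ^ 2 + R₁ ^ 2) = (l₂ ^ 2 + ρ₂ ^ 2) / (l₂ ^ 2 + R₂ ^ 2)) ∧
    (l₁ ^ 2 + ρ₁ ^ 2) / (l₁ ^ 2 + R₁ ^ 2) =
      (l₁ ^ 2 + (R₁ - 1 / |H|) ^ 2) / (l₁ ^ 2 + R₁ ^ 2) := by
  obtain ⟨a₁, m₁, M₁, ha₁, hprod₁, -, hp₁⟩ := h₁.exists_profile hH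
  obtain ⟨a₂, m₂, M₂, ha₂, hprod₂, -, hp₂⟩ := h₂.exists_profile hH
  have hthird : l₁ ^ 2 + ρ₁ ^ 2 = l₁ ^ 2 + (R₁ - 1 / |H|) ^ 2 := by
    rw [hρ₁, hR₁, h₁.innerRadius_sq hH]
  have hmρ₁ : l₁ ^ 2 + ρ₁ ^ 2 = m₁ := by rw [hρ₁, hp₁.sq_add_innerRadius_sq hH]
  have hMR₁ : l₁ ^ 2 + R₁ ^ 2 = M₁ := by rw [hR₁, hp₁.sq_add_outerRadius_sq hH]
  have hmρ₂ : l₂ ^ 2 + ρ₂ ^ 2 = m₂ := by rw [hρ₂, hp₂.sq_add_innerRadius_sq hH]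
  have hMR₂ : l₂ ^ 2 + R₂ ^ 2 = M₂ := by rw [hR₂, hp₂.sq_add_outerRadius_sq hH]
  have hratio : LocallyIsometric (helicoidalSurface l₁ c₁) (helicoidalSurface l₂ c₂) →
      m₁ / M₁ = m₂ / M₂ := fun h =>
    le_antisymm (IsConformalProfile.ratio_le_of_locallyIsometricInto hH h₂ h₁ hp₂ hp₁ h.2)
      (IsConformalProfile.ratio_le_of_locallyIsometricInto hH h₁ h₂ hp₁ hp₂ h.1)
  have hfamily : m₁ / M₁ = m₂ / M₂ →
      SameAssociatedFamily (helicoidalSurface l₁ c₁) (helicoidalSurface l₂ c₂) :=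
    sameAssociatedFamily_of_ratio_eq hH h₁ h₂ ha₁ ha₂ hprod₁ hprod₂ hp₁ hp₂
  refine ⟨?_, ?_, by rw [hthird]⟩
  · rw [hmρ₁, hMR₁, hmρ₂, hMR₂]
    exact ⟨fun h => hratio h.locallyIsometric, hfamily⟩
  · rw [hmρ₁, hMR₁, hmρ₂, hMR₂]
    exact ⟨hratio, fun h => (hfamily h).locallyIsometric⟩
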